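/- **Setting.** Fix a finite alphabet $\mathbb{A}$; data values are words $d\in\mathbb{A}^*$. Fix a set $\mathrm{Pat}$ of regular expressions over $\mathbb{A}$ (built from words by concatenation, union and star) and a countable set $\mathbb{Q}$ of properties (here: bit strings). *Filters* are $\varphi ::= \pi \mid q \mid \varphi\wedge\varphi\mid\neg\varphi$ with $\pi\in\mathrm{Pat}$, $q\in\mathbb{Q}$. For $d\in\mathbb{A}^*$ and $Q\subseteq\mathbb{Q}$, $(d,Q)\models\pi$ iff $d$ matches $\pi$, $(d,Q)\models q$ iff $q\in Q$, and $\wedge,\neg$ are as usual. *Singleton-membership of filters* is the problem, given $\varphi$, $d$ and $Q$ with $|Q|\le 1$, whether $(d,Q)\models\varphi$. *Trees* are the hereditarily finite multisets $\{d_1:t_1,\dots,d_n:t_n\}$ ($n\ge 0$, $d_i\in\mathbb{A}^*$, $t_i$ trees). A *horizontal automaton* $H$ consists of a finite set $P$ of horizontal states and a finite set of rules $p\xrightarrow{\varphi}p'$ with $p,p'\in P$ and $\varphi$ a filter. For multisets $M$ over $\mathbb{A}^*\times 2^{\mathbb{Q}}$ put $(p,M+\{d:Q\})\to(p',M)$ if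 $(d,Q)\models\varphi$ for some rule $p\xrightarrow{\varphi}p'$. $H$ is *confluent* if the relation obtained from $\to$ by adding $(p,M)\to\bot$ for all $M\neq\emptyset$ such that no step $(p,M)\to(p',M')$ exists is confluent. $M$ satisfies the descriptor $(p,p')\in P^2$ if $(p,M)\to^*(p',\emptyset)$. The support of a descriptor is the least $S\subseteq\mathbb{Q}$ such that satisfaction by $\{d_1:Q_1,\dots,d_n:Q_n\}$ depends only on the $d_i$ and $Q_i\cap S$. An *AUTC* $A$ consists of a confluent horizontal automaton $H$, a horizontal state $p_0$ of $H$, a finite set of states $\mathcal{Q}\subset\mathbb{Q}$, final states $F\subseteq\mathcal{Q}$, and a finite set of rules $(p_0,p')\to q$ with $p'\in P$, $q\in\mathcal{Q}$, where $(p_0,p')$ has support included in $\mathcal{Q}$, such that $A$ is *vertically deterministic*: the set $$[\![\{d_1:t_1,\dots,d_n:t_n\}]\!]_A=\bigl\{q : \{d_1:[\![t_1]\!]_A,\dots,d_n:[\![t_n]\!]_A\}\text{ satisfies }(p_0,p')\text{ for some rule }(p_0,p')\to q\bigr\}$$ has at most one element for every tree. Its language is $L(A)=\{t : [\![t]\!]_A\cap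 F\neq\emptyset\}$. **Proposition (AUTC membership).** If singleton-membership of filters is decidable in polynomial time, then there is a polynomial-time algorithm which, given any AUTC $A$ and any tree $t$ (both part of the input), decides whether $t\in L(A)$. Here polynomial time means: by a multi-stack Turing machine in a number of steps polynomial in the length of a standard string encoding of the input; a tree is given by any expression denoting it, and the membership algorithm is required to work on those inputs whose automaton is an AUTC. -/

import Mathlib

namespace UTA

/-! ## Data values, patterns and filters -/

/-- Regular expressions over the alphabet `α`; the atoms are words. -/
inductive Pattern (α : Type) : Type where
  | word (d : List α)
  | comp (π ρ : Pattern α)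
  | plus (π ρ : Pattern α)
  | star (π : Pattern α)

/-- The set of data values matched by a pattern. -/
def Pattern.lang {α : Type} : Pattern α → Language α
  | .word d => {d}
  | .comp π ρ => π.lang * ρ.lang
  | .plus π ρ => π.lang + ρ.lang
  | .star π => KStar.kstar π.lang

/-- The fixed countable set of properties (vertical states): bit strings. -/
abbrev Property : Type := List Bool

/-- Names of horizontal states: bit strings. -/
abbrev HState : Type := List Bool

/-- A data value together with a set of properties. -/
abbrev Item (α : Type) : Type := List α × Set Property

/-- Filters `φ ::= π | q | φ ∧ φ | ¬ φ` where `π` ranges over the class `Pat` of patterns. -/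
inductive EdgeFilter {α : Type} (Pat : Set (Pattern α)) : Type where
  | pat (π : Pat)
  | prop (q : Property)
  | conj (φ ψ : EdgeFilter Pat)
  | neg (φ : EdgeFilter Pat)

/-- `φ.Sat (d, Q)` means `(d, Q) ⊨ φ`. -/
def EdgeFilter.Sat {α : Type} {Pat : Set (Pattern α)} : EdgeFilter Pat → Item α → Prop
  | .pat π, x => x.1 ∈ π.1.lang
  | .prop q, x => q ∈ x.2
  | .conj φ ψ, x => φ.Sat x ∧ ψ.Sat x
  | .neg φ, x => ¬ φ.Sat x

/-! ## Unordered data trees -/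

/-- Written expressions for trees: `empty` is `⦃⦄`, and `add d t s` is `⦃d : t⦄ + s`. -/
inductive TreeTerm (α : Type) : Type where
  | empty
  | add (d : List α) (t s : TreeTerm α)

/-- Exchanging two neighbouring edges, anywhere in the expression. -/
inductive TreeTerm.Swap {α : Type} : TreeTerm α → TreeTerm α → Prop where
  | here (d₁ : List α) (t₁ : TreeTerm α) (d₂ : List α) (t₂ s : TreeTerm α) :
      Swap (.add d₁ t₁ (.add d₂ t₂ s)) (.add d₂ t₂ (.add d₁ t₁ s))
  | child (d : List α) {t t' : TreeTerm α} (s : TreeTerm α) :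
      Swap t t' → Swap (.add d t s) (.add d t' s)
  | rest (d : List α) (t : TreeTerm α) {s s' : TreeTerm α} :
      Swap s s' → Swap (.add d t s) (.add d t s')

/-- Unordered, edge-labelled data trees: hereditarily finite multisets `⦃d₁ : t₁, …, dₙ : tₙ⦄`,
that is, expressions up to the equivalence generated by exchanging edges. -/
def Tree (α : Type) : Type := Quot (TreeTerm.Swap (α := α))

/-- The tree denoted by an expression. -/
def TreeTerm.toTree {α : Type} (t : TreeTerm α) : Tree α := Quot.mk _ t

/-! ## Automata for unordered trees -/

/-- A descriptor class for models in `X`. (The size of an object, as an input of an algorithm, is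
the length of its encoding below.) -/
structure DescriptorClass (X : Type) where
  Desc : Type
  Sat : X → Desc → Prop

/-- The subclass of a descriptor class given by a set of descriptors. -/
def DescriptorClass.restrict {X : Type} (D : DescriptorClass X) (S : Set D.Desc) :
    DescriptorClass X where
  Desc := S
  Sat x h := D.Sat x h.1

/-- Horizontal descriptor classes: their models are multisets `⦃d₁ : Q₁, …, dₙ : Qₙ⦄`. -/
abbrev HorizontalClass (α : Type) : Type 1 := DescriptorClass (Multiset (Item α))

/-- Satisfaction of `h` by `⦃d₁ : Q₁, …, dₙ : Qₙ⦄` depends only on the sets `Qᵢ ∩ S`. -/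
def HorizontalClass.DependsOnlyOn {α : Type} (D : HorizontalClass α) (h : D.Desc)
    (S : Set Property) : Prop :=
  ∀ M : Multiset (List α × Set Property × Set Property),
    (∀ x ∈ M, x.2.1 ∩ S = x.2.2 ∩ S) →
      (D.Sat (M.map fun x => (x.1, x.2.1)) h ↔ D.Sat (M.map fun x => (x.1, x.2.2)) h)

/-- The support of a descriptor: the least set of properties on which it depends. -/
def HorizontalClass.support {α : Type} (D : HorizontalClass α) (h : D.Desc) : Set Property :=
  ⋂₀ {S | D.DependsOnlyOn h S}

/-- Alternating bottom-up automata for unordered unranked data trees with horizontal descriptor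
class `D`. The finite sets of states, final states and rules `h → q` are given by lists. -/
structure AUT {α : Type} (D : HorizontalClass α) where
  states : List Property
  final : List Property
  rules : List (D.Desc × Property)
  final_mem : ∀ q ∈ final, q ∈ states
  target_mem : ∀ r ∈ rules, r.2 ∈ states
  support_subset : ∀ r ∈ rules, D.support r.1 ⊆ {q | q ∈ states}

namespace AUT

variable {α : Type} {D : HorizontalClass α}

/-- The right-hand sides `q` of the rules `h → q` with `M ⊨ h`. -/
def targets (A : AUT D) (M : Multiset (Item α)) : Set Property :=
  {q | ∃ h, (h, q) ∈ A.rules ∧ D.Sat M h}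

/-- For `⦃d₁ : t₁, …, dₙ : tₙ⦄`, the multiset `⦃d₁ : ⟦t₁⟧, …, dₙ : ⟦tₙ⟧⦄`, where `⟦t⟧` is the
evaluation of `t`. -/
def annotate (A : AUT D) : TreeTerm α → Multiset (Item α)
  | .empty => 0
  | .add d t s => (d, A.targets (A.annotate t)) ::ₘ A.annotate s

theorem annotate_swap (A : AUT D) {t t' : TreeTerm α} (h : TreeTerm.Swap t t') :
    A.annotate t = A.annotate t' := by
  induction h with
  | here d₁ t₁ d₂ t₂ s => exact Multiset.cons_swap _ _ _
  | child d s _ ih => simp only [annotate, ih]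
  | rest d t _ ih => simp only [annotate, ih]

/-- The set of states to which `A` evaluates a tree. -/
def eval (A : AUT D) : Tree α → Set Property :=
  Quot.lift (fun t => A.targets (A.annotate t)) fun _ _ h => by rw [A.annotate_swap h]

/-- The language accepted by `A`. -/
def language (A : AUT D) : Set (Tree α) :=
  {t | (A.eval t ∩ {q | q ∈ A.final}).Nonempty}

/-- Every tree is evaluated to at most one state. -/
def VerticallyDeterministic (A : AUT D) : Prop :=
  ∀ t : Tree α, (A.eval t).Subsingleton

end AUT

/-! ## Horizontal automata and confluence -/

/-- Horizontal automata; the finite sets of states and rules are given by lists. -/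
structure HAut {α : Type} (Pat : Set (Pattern α)) where
  states : List HState
  rules : List (HState × EdgeFilter Pat × HState)
  rules_mem : ∀ r ∈ rules, r.1 ∈ states ∧ r.2.2 ∈ states

namespace HAut

variable {α : Type} {Pat : Set (Pattern α)}

/-- The horizontal rewriting relation. -/
inductive Rew (H : HAut Pat) :
    HState × Multiset (Item α) → HState × Multiset (Item α) → Prop where
  | read {p p' : HState} {φ : EdgeFilter Pat} {x : Item α} (M : Multiset (Item α)) :
      (p, φ, p') ∈ H.rules → φ.Sat x → Rew H (p, x ::ₘ M) (p', M)

/-- The failure-extended horizontal rewriting relation; `none` is the failure `⊥`. -/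
inductive RewFail (H : HAut Pat) :
    Option (HState × Multiset (Item α)) → Option (HState × Multiset (Item α)) → Prop where
  | step {c c' : HState × Multiset (Item α)} : H.Rew c c' → RewFail H (some c) (some c')
  | fail {p : HState} {M : Multiset (Item α)} :
      M ≠ 0 → (¬ ∃ c', H.Rew (p, M) c') → RewFail H (some (p, M)) none

/-- Confluence of the failure-extended horizontal rewriting relation. -/
def Confluent (H : HAut Pat) : Prop :=
  ∀ a b c, Relation.ReflTransGen H.RewFail a b → Relation.ReflTransGen H.RewFail a c →
    ∃ d, Relation.ReflTransGen H.RewFail b d ∧ Relation.ReflTransGen H.RewFail c d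

/-- The descriptor class of a horizontal automaton: the descriptors are pairs `(p, p')` of
horizontal states, and `M ⊨ (p, p')` if `p'` can be reached from `p` while consuming `M`. -/
def descriptors (H : HAut Pat) : HorizontalClass α where
  Desc := {p // p ∈ H.states} × {p // p ∈ H.states}
  Sat M h := Relation.ReflTransGen H.Rew (h.1.1, M) (h.2.1, 0)

/-- The subclass of the descriptors `(p₀, p')`. -/
def descriptorsFrom (H : HAut Pat) (p₀ : {p // p ∈ H.states}) : HorizontalClass α :=
  DescriptorClass.restrict H.descriptors {h | h.1 = p₀}

end HAut

/-- Vertically deterministic automata with a confluent horizontal automaton `H` and a single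
initial horizontal state `p₀`. -/
structure AUTC {α : Type} (Pat : Set (Pattern α)) where
  H : HAut Pat
  p₀ : {p // p ∈ H.states}
  A : AUT (H.descriptorsFrom p₀)
  confluent : H.Confluent
  deterministic : A.VerticallyDeterministic

/-- The language accepted by an `AUTC`. -/
def AUTC.language {α : Type} {Pat : Set (Pattern α)} (C : AUTC Pat) : Set (Tree α) :=
  C.A.language

/-! ## Encodings as strings over a finite alphabet -/

/-- The letters of the input alphabet of the machines. -/
inductive Tok (α : Type) : Type where
  | letter (a : α)
  | bit (b : Bool)
  | close
  | item
  | word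
  | comp
  | plus
  | star
  | pat
  | prop
  | conj
  | neg

section Encodings

variable {α : Type} {Pat : Set (Pattern α)}

def encodeWord (d : List α) : List (Tok α) := d.map Tok.letter ++ [Tok.close]

def encodeName (q : List Bool) : List (Tok α) := q.map Tok.bit ++ [Tok.close]

def encodeList {β : Type} (e : β → List (Tok α)) : List β → List (Tok α)
  | [] => [Tok.close]
  | x :: xs => Tok.item :: (e x ++ encodeList e xs)

def Pattern.encode : Pattern α → List (Tok α)
  | .word d => Tok.word :: encodeWord d
  | .comp π ρ => Tok.comp :: (π.encode ++ ρ.encode)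
  | .plus π ρ => Tok.plus :: (π.encode ++ ρ.encode)
  | .star π => Tok.star :: π.encode

def EdgeFilter.encode : EdgeFilter Pat → List (Tok α)
  | .pat π => Tok.pat :: π.1.encode
  | .prop q => Tok.prop :: encodeName q
  | .conj φ ψ => Tok.conj :: (φ.encode ++ ψ.encode)
  | .neg φ => Tok.neg :: φ.encode

def TreeTerm.encode : TreeTerm α → List (Tok α)
  | .empty => [Tok.close]
  | .add d t s => Tok.item :: (encodeWord d ++ t.encode ++ s.encode)

def HAut.encode (H : HAut Pat) : List (Tok α) :=
  encodeList encodeName H.states ++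
    encodeList (fun r => encodeName r.1 ++ r.2.1.encode ++ encodeName r.2.2) H.rules

/-- As all descriptors of an `AUTC` have the same initial horizontal state `p₀`, a vertical rule
`(p₀, p') → q` is written as `p'` followed by `q`. -/
def AUTC.encode (C : AUTC Pat) : List (Tok α) :=
  C.H.encode ++ encodeName C.p₀.1 ++ encodeList encodeName C.A.states ++
    encodeList encodeName C.A.final ++
    encodeList (fun r => encodeName r.1.1.2.1 ++ encodeName r.2) C.A.rules

end Encodings

/-! ## Polynomial time and the two decision problems -/

/-- The property `P` of inputs `x`, written as `enc x`, is decided by a (multi-stack) Turing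
machine whose number of steps is bounded by a polynomial in the length of `enc x`. -/
def InPTime {β Γ : Type} (enc : β → List Γ) (P : β → Prop) : Prop :=
  open Classical in
  Nonempty (Turing.TM2ComputableInPolyTime enc Computability.encodeBool fun x => decide (P x))

/-- Inputs `(φ, d, Q)` of singleton-membership; `Q` is empty (`none`) or a singleton. -/
abbrev SingletonInstance {α : Type} (Pat : Set (Pattern α)) : Type :=
  EdgeFilter Pat × List α × Option Property

def SingletonInstance.encode {α : Type} {Pat : Set (Pattern α)} (x : SingletonInstance Pat) :
    List (Tok α) :=
  EdgeFilter.encode x.1 ++ encodeWord x.2.1 ++ encodeList encodeName x.2.2.toList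

/-- Whether `(d, Q) ⊨ φ`. -/
def SingletonInstance.Holds {α : Type} {Pat : Set (Pattern α)} (x : SingletonInstance Pat) :
    Prop :=
  EdgeFilter.Sat x.1 (x.2.1, {q | x.2.2 = some q})

/-- Inputs of the membership problem: an `AUTC` and a tree, given by any expression for it. -/
abbrev MembershipInstance {α : Type} (Pat : Set (Pattern α)) : Type :=
  AUTC Pat × TreeTerm α

def MembershipInstance.encode {α : Type} {Pat : Set (Pattern α)} (x : MembershipInstance Pat) :
    List (Tok α) :=
  AUTC.encode x.1 ++ TreeTerm.encode x.2

/-- Whether `t ∈ L(A)`. -/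
def MembershipInstance.Holds {α : Type} {Pat : Set (Pattern α)} (x : MembershipInstance Pat) :
    Prop :=
  TreeTerm.toTree x.2 ∈ AUTC.language x.1

end UTA

/-! Evaluate the tree bottom-up. Vertical determinism says that every subtree evaluates to at most
one state, so each item `(d, Q)` that a horizontal rule has to test has `|Q| ≤ 1`, and
singleton-membership of filters suffices as a subroutine. It remains to decide which descriptors
`(p₀, p')` a multiset of such items satisfies.

A greedy run does this: apply rules to items in any order until nothing more can be consumed. It
ends either with all items consumed, in some state `p₁`, or with remaining items none of which can
be consumed, in which case the failure-extended relation leads to `⊥`. The configurations `(p', ∅)`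
and `⊥` are irreducible. Hence by confluence, if some run reaches `(p', ∅)`, then the greedy run
cannot fail and must end in the same state `p' = p₁` (`run_iff`). One run from `p₀` therefore serves
all vertical rules at once (`AUTC.mem_targets`), and by determinism any matching vertical rule gives
the value of the subtree (`AUTC.value_eq`). The whole tree is evaluated by a single right-to-left
scan of its encoding with a stack of lists of items (`AUTC.readTree_encode`), which yields
`AUTC.accepts_iff`.

The polynomial bound on Turing machines comes from a small calculus. Machine fragments are composed
by relabelling (`Steps.relabel`). Data are binary trees in prefix notation on one main stack. `PT`
is the class of functions on such data that run in polynomial time and have values of polynomial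
size. It is closed under composition, pairing, case distinction, calls of the given filter decider
(`PT.oracle`), and iteration over a list when every step adds only a polynomial amount depending on
the list element and a fixed parameter (`PT.foldl_param`). This additive growth condition keeps
nested iterations polynomial; it holds in the algorithm because states are always taken from the
input automaton. `PT.inPTime` turns a Boolean function in `PT` into a machine of the required form.
-/

namespace UTA

open Turing

/-! ## Program fragments for stack machines -/

section Fragments

variable {K : Type} [DecidableEq K] {Γ : K → Type} {Λ Λ' σ : Type}

/-- `Steps m n c c'`: the machine `m` moves from `c` to `c'` in exactly `n` steps. -/
def Steps (m : Λ → TM2.Stmt Γ Λ σ) : ℕ → TM2.Cfg Γ Λ σ → TM2.Cfg Γ Λ σ → Prop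
  | 0, c, c' => c = c'
  | n + 1, c, c' => ∃ d, TM2.step m c = some d ∧ Steps m n d c'

theorem Steps.trans {m : Λ → TM2.Stmt Γ Λ σ} {i j : ℕ} {c d e : TM2.Cfg Γ Λ σ}
    (h : Steps m i c d) (h' : Steps m j d e) : Steps m (i + j) c e := by
  induction i generalizing c with
  | zero => cases h; simpa using h'
  | succ i ih =>
    obtain ⟨x, hx, h⟩ := h
    rw [Nat.succ_add]
    exact ⟨x, hx, ih h⟩

/-- The right-hand side is the form in which `TM2OutputsInTime` counts steps; the left-hand side is
the form suited to induction. -/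
theorem steps_iff_iterate {m : Λ → TM2.Stmt Γ Λ σ} {n : ℕ} {c c' : TM2.Cfg Γ Λ σ} :
    Steps m n c c' ↔ (flip bind (TM2.step m))^[n] (some c) = some c' := by
  induction n generalizing c with
  | zero => simp [Steps]
  | succ n ih =>
    have hnone : ∀ k, (flip bind (TM2.step m))^[k] none = none := fun k => by
      induction k with
      | zero => rfl
      | succ k ihk => rw [Function.iterate_succ_apply]; exact ihk
    rw [Function.iterate_succ_apply]
    change (∃ d, TM2.step m c = some d ∧ Steps m n d c') ↔
      (flip bind (TM2.step m))^[n] (TM2.step m c) = some c'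
    cases h : TM2.step m c with
    | none => simpa using (hnone n).trans_ne (Option.some_ne_none c').symm
    | some d => simp [ih]

/-- Rename the labels of a statement by `f` and replace halting by a jump to `h`. -/
def relabel (f : Λ → Λ') (h : Option Λ') : TM2.Stmt Γ Λ σ → TM2.Stmt Γ Λ' σ
  | .push k g q => .push k g (relabel f h q)
  | .peek k g q => .peek k g (relabel f h q)
  | .pop k g q => .pop k g (relabel f h q)
  | .load g q => .load g (relabel f h q)
  | .branch g q q' => .branch g (relabel f h q) (relabel f h q')
  | .goto g => .goto fun v => f (g v)
  | .halt => h.elim .halt fun l => .goto fun _ => l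

/-- The configuration corresponding to `c` after relabelling. -/
def relabelCfg (f : Λ → Λ') (h : Option Λ') (c : TM2.Cfg Γ Λ σ) : TM2.Cfg Γ Λ' σ :=
  ⟨c.l.elim h fun l => some (f l), c.var, c.stk⟩

theorem stepAux_relabel (f : Λ → Λ') (h : Option Λ') (q : TM2.Stmt Γ Λ σ) (v : σ)
    (S : ∀ k, List (Γ k)) :
    TM2.stepAux (relabel f h q) v S = relabelCfg f h (TM2.stepAux q v S) := by
  induction q generalizing v S with
  | push | peek | pop | load => simp only [relabel, TM2.stepAux, *]
  | branch g q q' ih ih' => cases hg : g v <;> simp [relabel, TM2.stepAux, hg, ih, ih']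
  | goto => rfl
  | halt => cases h <;> rfl

/-- The basis of all composition of fragments. Replacing `halt` by a jump happens inside the last
statement, so no extra step is spent, and a halted configuration of the part becomes the
configuration at the entry label `h` of whatever follows. -/
theorem Steps.relabel {f : Λ → Λ'} {h : Option Λ'} {m : Λ → TM2.Stmt Γ Λ σ}
    {m' : Λ' → TM2.Stmt Γ Λ' σ} (hm : ∀ l, m' (f l) = relabel f h (m l)) {n : ℕ}
    {c c' : TM2.Cfg Γ Λ σ} (H : Steps m n c c') :
    Steps m' n (relabelCfg f h c) (relabelCfg f h c') := by
  induction n generalizing c with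
  | zero => cases H; rfl
  | succ n ih =>
    obtain ⟨d, hd, H⟩ := H
    obtain ⟨_ | l, v, S⟩ := c
    · simp at hd
    · refine ⟨_, ?_, ih H⟩
      simp only [TM2.step, Option.some.injEq] at hd
      rw [← hd, ← stepAux_relabel, ← hm]
      rfl

variable (Γ σ) in
/-- A machine without distinguished stacks. -/
structure Frag where
  Λ : Type
  fin : Fintype Λ
  main : Λ
  m : Λ → TM2.Stmt Γ Λ σ

namespace Frag

/-- Started with variable and stacks `x`, the fragment halts with `y` after at most `t` steps. -/
def Runs (F : Frag Γ σ) (t : ℕ) (x y : σ × ∀ k, List (Γ k)) : Prop :=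
  ∃ n ≤ t, Steps F.m n ⟨some F.main, x.1, x.2⟩ ⟨none, y.1, y.2⟩

theorem Runs.mono {F : Frag Γ σ} {s t : ℕ} {x y : σ × ∀ k, List (Γ k)} (h : F.Runs s x y)
    (hst : s ≤ t) : F.Runs t x y :=
  let ⟨n, hn, H⟩ := h; ⟨n, hn.trans hst, H⟩

/-- A single statement, where `goto` repeats it. -/
def single (q : TM2.Stmt Γ Unit σ) : Frag Γ σ := ⟨Unit, inferInstance, (), fun _ => q⟩

theorem runs_single {q : TM2.Stmt Γ Unit σ} {v v' : σ} {S S' : ∀ k, List (Γ k)}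
    (h : TM2.stepAux q v S = ⟨none, v', S'⟩) : (single q).Runs 1 (v, S) (v', S') :=
  ⟨1, le_rfl, _, congrArg some h, rfl⟩

theorem runs_single_again {q : TM2.Stmt Γ Unit σ} {v v' : σ} {S S' : ∀ k, List (Γ k)}
    {y : σ × ∀ k, List (Γ k)} {t : ℕ} (h : TM2.stepAux q v S = ⟨some (), v', S'⟩)
    (H : (single q).Runs t (v', S') y) : (single q).Runs (t + 1) (v, S) y :=
  let ⟨n, hn, H⟩ := H; ⟨n + 1, Nat.succ_le_succ hn, _, congrArg some h, H⟩

/-- First `F`, then `G`. -/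
def seq (F G : Frag Γ σ) : Frag Γ σ where
  Λ := F.Λ ⊕ G.Λ
  fin := letI := F.fin; letI := G.fin; inferInstance
  main := .inl F.main
  m := Sum.elim (fun l => relabel .inl (some (.inr G.main)) (F.m l))
    fun l => relabel .inr none (G.m l)

theorem Runs.seq {F G : Frag Γ σ} {s t : ℕ} {x y z : σ × ∀ k, List (Γ k)} (h : F.Runs s x y)
    (h' : G.Runs t y z) : (F.seq G).Runs (s + t) x z := by
  obtain ⟨i, hi, H⟩ := h
  obtain ⟨j, hj, H'⟩ := h'
  exact ⟨i + j, Nat.add_le_add hi hj,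
    (H.relabel (f := .inl) (h := some (.inr G.main)) (m' := (F.seq G).m) fun _ => rfl).trans
      (H'.relabel (f := .inr) (h := none) (m' := (F.seq G).m) fun _ => rfl)⟩

/-- Perform `q`; go on with `F` if it jumps to `true` and with `G` if it jumps to `false`. -/
def ite (q : TM2.Stmt Γ Bool σ) (F G : Frag Γ σ) : Frag Γ σ where
  Λ := Option (F.Λ ⊕ G.Λ)
  fin := letI := F.fin; letI := G.fin; inferInstance
  main := none
  m l := l.elim (relabel (fun b => some (cond b (.inl F.main) (.inr G.main))) none q)
    (Sum.elim (fun l => relabel (fun l => some (.inl l)) none (F.m l))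
      fun l => relabel (fun l => some (.inr l)) none (G.m l))

theorem runs_ite {F G : Frag Γ σ} {q : TM2.Stmt Γ Bool σ} {b : Bool} {t : ℕ} {v v' : σ}
    {S S' : ∀ k, List (Γ k)} {y : σ × ∀ k, List (Γ k)}
    (h : TM2.stepAux q v S = ⟨some b, v', S'⟩) (H : (cond b F G).Runs t (v', S') y) :
    (ite q F G).Runs (t + 1) (v, S) y := by
  obtain ⟨n, hn, H⟩ := H
  refine ⟨n + 1, Nat.succ_le_succ hn, _, rfl, ?_⟩
  refine (congrArg (Steps (ite q F G).m n · _) ((stepAux_relabel _ _ q v S).trans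
    (congrArg _ h))).mpr ?_
  cases b
  · exact H.relabel (f := fun l => some (.inr l)) (h := none) (m' := (ite q F G).m) fun _ => rfl
  · exact H.relabel (f := fun l => some (.inl l)) (h := none) (m' := (ite q F G).m) fun _ => rfl

/-- Perform `q`; if it jumps, do `F` and repeat. -/
def loop (q : TM2.Stmt Γ Unit σ) (F : Frag Γ σ) : Frag Γ σ where
  Λ := Option F.Λ
  fin := letI := F.fin; inferInstance
  main := none
  m l := l.elim (relabel (fun _ => some F.main) none q)
    fun l => relabel some (some none) (F.m l)

theorem runs_loop {F : Frag Γ σ} {q : TM2.Stmt Γ Unit σ} {v v' : σ} {S S' : ∀ k, List (Γ k)}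
    (h : TM2.stepAux q v S = ⟨none, v', S'⟩) : (loop q F).Runs 1 (v, S) (v', S') := by
  refine ⟨1, le_rfl, _, rfl, ?_⟩
  exact (stepAux_relabel _ _ q v S).trans (congrArg _ h)

theorem runs_loop_again {F : Frag Γ σ} {q : TM2.Stmt Γ Unit σ} {v v' : σ}
    {S S' : ∀ k, List (Γ k)} {y z : σ × ∀ k, List (Γ k)} {s t : ℕ}
    (h : TM2.stepAux q v S = ⟨some (), v', S'⟩) (H : F.Runs s (v', S') y)
    (H' : (loop q F).Runs t y z) : (loop q F).Runs (s + t + 1) (v, S) z := by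
  obtain ⟨i, hi, H⟩ := H
  obtain ⟨j, hj, H'⟩ := H'
  refine ⟨(i + j) + 1, by omega, _, rfl, ?_⟩
  refine (congrArg (Steps (loop q F).m (i + j) · _) ((stepAux_relabel _ _ q v S).trans
    (congrArg _ h))).mpr ?_
  exact (H.relabel (f := some) (h := some none) (m' := (loop q F).m) fun _ => rfl).trans H'

end Frag

end Fragments

/-! ## Data and memory -/

/-- Binary trees whose leaves are letters or `nil`. -/
inductive Val (τ : Type) : Type where
  | nil
  | tok (a : τ)
  | cons (x y : Val τ)

/-- Stack symbols for the prefix notation of binary trees. -/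
inductive Sym (τ : Type) : Type where
  | nil
  | tok (a : τ)
  | cons

noncomputable instance {τ : Type} [Fintype τ] : Fintype (Sym τ) :=
  letI := Classical.decEq (Sym τ)
  Fintype.ofSurjective
    (fun x : Option (Option τ) => x.elim .nil fun y => y.elim .cons .tok) fun x => by
      cases x
      exacts [⟨none, rfl⟩, ⟨some (some _), rfl⟩, ⟨some none, rfl⟩]

/-- Prefix notation. -/
def Val.code {τ : Type} : Val τ → List (Sym τ)
  | .nil => [.nil]
  | .tok a => [.tok a]
  | .cons x y => .cons :: (x.code ++ y.code)

/-- The working stacks. -/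
inductive Reg : Type where
  | main | a | b | c | d
  deriving DecidableEq

instance : Fintype Reg := ⟨{.main, .a, .b, .c, .d}, fun x => by cases x <;> simp⟩

/-- Names of stacks: working stacks, an input and an output stack, and those of a subroutine. -/
inductive Stk (K : Type) : Type where
  | reg (r : Reg)
  | inp
  | out
  | sub (k : K)
  deriving DecidableEq

instance {K : Type} [DecidableEq K] [Fintype K] : Fintype (Stk K) :=
  Fintype.ofSurjective
    (fun x : Reg ⊕ Bool ⊕ K => x.elim .reg fun y => y.elim (fun b => cond b .inp .out) .sub)
    fun x => by
      cases x
      exacts [⟨.inl _, rfl⟩, ⟨.inr (.inl true), rfl⟩, ⟨.inr (.inl false), rfl⟩,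
        ⟨.inr (.inr _), rfl⟩]

/-- The alphabets of the stacks. -/
abbrev stkΓ (τ : Type) {K : Type} (Γ : K → Type) : Stk K → Type
  | .reg _ => Sym τ
  | .inp => τ
  | .out => Bool
  | .sub k => Γ k

/-- The contents of the stacks other than those of the subroutine. -/
structure Mem (τ : Type) where
  main : List (Sym τ) := []
  a : List (Sym τ) := []
  b : List (Sym τ) := []
  c : List (Sym τ) := []
  d : List (Sym τ) := []
  inp : List τ := []
  out : List Bool := []

section Store

variable {τ K : Type} {Γ : K → Type}

/-- The contents of all stacks. -/
def store (M : Mem τ) (S : ∀ k, List (Γ k)) : ∀ k, List (stkΓ τ Γ k)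
  | .reg .main => M.main
  | .reg .a => M.a
  | .reg .b => M.b
  | .reg .c => M.c
  | .reg .d => M.d
  | .inp => M.inp
  | .out => M.out
  | .sub k => S k

variable (M : Mem τ) (S : ∀ k, List (Γ k))

@[simp] theorem store_main : store M S (.reg .main) = M.main := rfl
@[simp] theorem store_a : store M S (.reg .a) = M.a := rfl
@[simp] theorem store_b : store M S (.reg .b) = M.b := rfl
@[simp] theorem store_c : store M S (.reg .c) = M.c := rfl
@[simp] theorem store_d : store M S (.reg .d) = M.d := rfl
@[simp] theorem store_inp : store M S .inp = M.inp := rfl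
@[simp] theorem store_out : store M S .out = M.out := rfl
@[simp] theorem store_sub (k : K) : store M S (.sub k) = S k := rfl

variable [DecidableEq K]

@[simp] theorem store_update_main (l : List (Sym τ)) :
    Function.update (store M S) (.reg .main) l = store { M with main := l } S := by
  funext k; rcases k with (_ | _ | _ | _ | _) | _ | _ | _ <;> simp [Function.update, store]

@[simp] theorem store_update_a (l : List (Sym τ)) :
    Function.update (store M S) (.reg .a) l = store { M with a := l } S := by
  funext k; rcases k with (_ | _ | _ | _ | _) | _ | _ | _ <;> simp [Function.update, store]

@[simp] theorem store_update_b (l : List (Sym τ)) :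
    Function.update (store M S) (.reg .b) l = store { M with b := l } S := by
  funext k; rcases k with (_ | _ | _ | _ | _) | _ | _ | _ <;> simp [Function.update, store]

@[simp] theorem store_update_c (l : List (Sym τ)) :
    Function.update (store M S) (.reg .c) l = store { M with c := l } S := by
  funext k; rcases k with (_ | _ | _ | _ | _) | _ | _ | _ <;> simp [Function.update, store]

@[simp] theorem store_update_d (l : List (Sym τ)) :
    Function.update (store M S) (.reg .d) l = store { M with d := l } S := by
  funext k; rcases k with (_ | _ | _ | _ | _) | _ | _ | _ <;> simp [Function.update, store]

@[simp] theorem store_update_inp (l : List τ) :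
    Function.update (store M S) .inp l = store { M with inp := l } S := by
  funext k; rcases k with (_ | _ | _ | _ | _) | _ | _ | _ <;> simp [Function.update, store]

@[simp] theorem store_update_out (l : List Bool) :
    Function.update (store M S) .out l = store { M with out := l } S := by
  funext k; rcases k with (_ | _ | _ | _ | _) | _ | _ | _ <;> simp [Function.update, store]

@[simp] theorem store_update_sub (k : K) (l : List (Γ k)) :
    Function.update (store M S) (.sub k) l = store M (Function.update S k l) := by
  funext k'
  rcases k' with (_ | _ | _ | _ | _) | _ | _ | k' <;> simp [Function.update, store]
  split_ifs with h
  · subst h; rfl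
  · rfl

end Store

/-! ## Basic stack programs -/

/-- Two buffers for stack symbols. -/
abbrev Buf (τ : Type) : Type := Option (Sym τ) × Option (Sym τ)

/-- Whether the first buffer holds `cons`. -/
def Buf.isCons {τ : Type} (v : Buf τ) : Bool :=
  match v.1 with
  | some .cons => true
  | _ => false

section Basic

variable {τ K : Type} [DecidableEq K] {Γ : K → Type} {ς : Type}

/-- `mk l` is a store whose register `r` contains `l`, uniformly in `l`. -/
structure Slot (r : Reg) (mk : List (Sym τ) → ∀ k, List (stkΓ τ Γ k)) : Prop where
  get : ∀ l, mk l (.reg r) = l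
  set : ∀ l l', Function.update (mk l) (.reg r) l' = mk l'

namespace Frag

/-- Pop a symbol from `r` into the first buffer. -/
def popTo (r : Reg) {Λ : Type} (q : TM2.Stmt (stkΓ τ Γ) Λ (Buf τ × ς)) :
    TM2.Stmt (stkΓ τ Γ) Λ (Buf τ × ς) :=
  .pop (.reg r) (fun v s => ((s, none), v.2)) q

/-- Push the symbol in the first buffer to `r`. -/
def pushFrom (r : Reg) {Λ : Type} (q : TM2.Stmt (stkΓ τ Γ) Λ (Buf τ × ς)) :
    TM2.Stmt (stkΓ τ Γ) Λ (Buf τ × ς) :=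
  .push (.reg r) (fun v => v.1.1.getD .nil) q

/-- Push the symbol `s` to `r`. -/
def pushSym (r : Reg) (s : Sym τ) {Λ : Type} (q : TM2.Stmt (stkΓ τ Γ) Λ (Buf τ × ς)) :
    TM2.Stmt (stkΓ τ Γ) Λ (Buf τ × ς) :=
  .push (.reg r) (fun _ => s) q

/-- Clear the buffers and halt. -/
def done {Λ : Type} : TM2.Stmt (stkΓ τ Γ) Λ (Buf τ × ς) :=
  .load (fun v => ((none, none), v.2)) .halt

/-- Repeat. -/
def again : TM2.Stmt (stkΓ τ Γ) Unit (Buf τ × ς) := .goto fun _ => ()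

/-- The body of `moveTerm`; `c` counts the terms that are still to be moved. -/
def moveTermBody (dst : Reg) : TM2.Stmt (stkΓ τ Γ) Unit (Buf τ × ς) :=
  popTo .c <| .branch (fun v => v.1.1.isSome)
    (popTo .main <| pushFrom dst <|
      .branch (fun v => v.1.isCons) (pushSym .c .nil <| pushSym .c .nil again) again)
    done

/-- In prefix notation a term ends when a counter of pending terms drops by one: a leaf completes
one term, `cons` replaces one pending term by two. The statement is in continuation form: `H`
describes the run after the term has been moved. It is required for every buffer content, since the
buffer then holds the last symbol read. -/
theorem runs_moveTermBody {dst : Reg} {mk : List (Sym τ) → List (Sym τ) → List (Sym τ) →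
      ∀ k, List (stkΓ τ Γ k)}
    (hc : ∀ m d, Slot .c fun c => mk c m d) (hm : ∀ c d, Slot .main fun m => mk c m d)
    (hd : ∀ c m, Slot dst fun d => mk c m d) (x : Val τ) (k : ℕ) (r D : List (Sym τ)) (t : ℕ)
    (w : ς) (y : (Buf τ × ς) × ∀ k, List (stkΓ τ Γ k))
    (H : ∀ v, (single (moveTermBody dst)).Runs t
      ((v, w), mk (List.replicate k .nil) r (x.code.reverse ++ D)) y) (v : Buf τ) :
    (single (moveTermBody dst)).Runs (t + x.code.length)
      ((v, w), mk (List.replicate (k + 1) .nil) (x.code ++ r) D) y := by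
  have c1 := fun c m d => (hc m d).get c
  have c2 := fun c m d => (hc m d).set c
  have m1 := fun c m d => (hm c d).get m
  have m2 := fun c m d => (hm c d).set m
  have d1 := fun c m d => (hd c m).get d
  have d2 := fun c m d => (hd c m).set d
  induction x generalizing k r D t v with
  | nil =>
    refine runs_single_again ?_ (H (some .nil, none))
    simp [moveTermBody, popTo, pushFrom, Buf.isCons, again, c1, c2, m1, m2, d1, d2, Val.code,
      List.replicate_succ]
  | tok a =>
    refine runs_single_again ?_ (H (some (.tok a), none))
    simp [moveTermBody, popTo, pushFrom, Buf.isCons, again, c1, c2, m1, m2, d1, d2, Val.code,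
      List.replicate_succ]
  | cons x₁ x₂ ih₁ ih₂ =>
    -- The run on `x₂` serves as the continuation of the run on `x₁`.
    have h := ih₁ (k + 1) (x₂.code ++ r) (.cons :: D) _
      (ih₂ k r (x₁.code.reverse ++ .cons :: D) t fun v => by simpa [Val.code] using H v)
    refine (runs_single_again (S' := mk (List.replicate (k + 1 + 1) .nil)
      (x₁.code ++ (x₂.code ++ r)) (.cons :: D)) ?_ (h (some .cons, none))).mono ?_
    · simp [moveTermBody, popTo, pushFrom, pushSym, Buf.isCons, again, c1, c2, m1, m2, d1, d2,
        Val.code, List.replicate_succ]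
    · simp [Val.code]; omega

/-- Move the topmost term from `main` to `dst`. -/
def moveTerm (dst : Reg) : Frag (stkΓ τ Γ) (Buf τ × ς) :=
  (single (pushSym .c .nil .halt)).seq (single (moveTermBody dst))

theorem runs_moveTerm {dst : Reg} {mk : List (Sym τ) → List (Sym τ) → List (Sym τ) →
      ∀ k, List (stkΓ τ Γ k)}
    (hc : ∀ m d, Slot .c fun c => mk c m d) (hm : ∀ c d, Slot .main fun m => mk c m d)
    (hd : ∀ c m, Slot dst fun d => mk c m d) (x : Val τ) (r D : List (Sym τ)) (w : ς) :
    (moveTerm dst).Runs (x.code.length + 2)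
      (((none, none), w), mk [] (x.code ++ r) D)
      (((none, none), w), mk [] r (x.code.reverse ++ D)) := by
  refine (Runs.seq (runs_single ?_) (runs_moveTermBody hc hm hd x 0 r D 1 w _
    (fun v => runs_single ?_) (none, none))).mono (by omega)
  · simp [pushSym, (hc _ _).get, (hc _ _).set]
  · simp [moveTermBody, popTo, done, (hc _ _).get, (hc _ _).set]

/-- Move all symbols from `src` to `dst`. -/
def moveAll (src dst : Reg) : Frag (stkΓ τ Γ) (Buf τ × ς) :=
  single <| popTo src <| .branch (fun v => v.1.1.isSome) (pushFrom dst again) done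

theorem runs_moveAll {src dst : Reg} {mk : List (Sym τ) → List (Sym τ) → ∀ k, List (stkΓ τ Γ k)}
    (hs : ∀ d, Slot src fun s => mk s d) (hd : ∀ s, Slot dst fun d => mk s d)
    (L D : List (Sym τ)) (v : Buf τ) (w : ς) :
    (moveAll src dst).Runs (L.length + 1) ((v, w), mk L D)
      (((none, none), w), mk [] (L.reverse ++ D)) := by
  have s1 := fun s d => (hs d).get s
  have s2 := fun s d => (hs d).set s
  have d1 := fun s d => (hd s).get d
  have d2 := fun s d => (hd s).set d
  induction L generalizing D v with
  | nil => exact runs_single (by simp [popTo, done, s1, s2])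
  | cons a L ih =>
    refine runs_single_again ?_ (by simpa [moveAll] using ih (a :: D) (some a, none))
    simp [popTo, pushFrom, again, s1, s2, d1, d2]

/-- Move all symbols from `src` to both `dst` and `dst'`. -/
def moveBoth (src dst dst' : Reg) : Frag (stkΓ τ Γ) (Buf τ × ς) :=
  single <| popTo src <| .branch (fun v => v.1.1.isSome)
    (pushFrom dst <| pushFrom dst' again) done

theorem runs_moveBoth {src dst dst' : Reg} {mk : List (Sym τ) → List (Sym τ) → List (Sym τ) →
      ∀ k, List (stkΓ τ Γ k)}
    (hs : ∀ d e, Slot src fun s => mk s d e) (hd : ∀ s e, Slot dst fun d => mk s d e)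
    (he : ∀ s d, Slot dst' fun e => mk s d e)
    (L D E : List (Sym τ)) (v : Buf τ) (w : ς) :
    (moveBoth src dst dst').Runs (L.length + 1) ((v, w), mk L D E)
      (((none, none), w), mk [] (L.reverse ++ D) (L.reverse ++ E)) := by
  have s1 := fun s d e => (hs d e).get s
  have s2 := fun s d e => (hs d e).set s
  have d1 := fun s d e => (hd s e).get d
  have d2 := fun s d e => (hd s e).set d
  have e1 := fun s d e => (he s d).get e
  have e2 := fun s d e => (he s d).set e
  induction L generalizing D E v with
  | nil => exact runs_single (by simp [popTo, done, s1, s2])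
  | cons a L ih =>
    refine runs_single_again ?_ (by simpa [moveBoth] using ih (a :: D) (a :: E) (some a, none))
    simp [popTo, pushFrom, again, s1, s2, d1, d2, e1, e2]

/-- Remove all symbols from `src`. -/
def clear (src : Reg) : Frag (stkΓ τ Γ) (Buf τ × ς) :=
  single <| popTo src <| .branch (fun v => v.1.1.isSome) again done

theorem runs_clear {src : Reg} {mk : List (Sym τ) → ∀ k, List (stkΓ τ Γ k)}
    (hs : Slot src mk) (L : List (Sym τ)) (v : Buf τ) (w : ς) :
    (clear src).Runs (L.length + 1) ((v, w), mk L) (((none, none), w), mk []) := by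
  induction L generalizing v with
  | nil => exact runs_single (by simp [popTo, done, hs.get, hs.set])
  | cons a L ih =>
    refine runs_single_again ?_ (ih (some a, none))
    simp [popTo, again, hs.get, hs.set]

/-- The fragment replaces `x` by `y` on top of `main` in at most `t` steps; otherwise, the stacks
are empty and the state is `w`. -/
def Computes (F : Frag (stkΓ τ Γ) (Buf τ × ς)) (w : ς) (t : ℕ) (x y : List (Sym τ)) : Prop :=
  ∀ r, F.Runs t (((none, none), w), store { main := x ++ r } fun _ => [])
    (((none, none), w), store { main := y ++ r } fun _ => [])

variable {w : ς}

theorem Computes.mono {F : Frag (stkΓ τ Γ) (Buf τ × ς)} {s t : ℕ} {x y : List (Sym τ)}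
    (h : F.Computes w s x y) (hst : s ≤ t) : F.Computes w t x y := fun r => (h r).mono hst

theorem Computes.seq {F G : Frag (stkΓ τ Γ) (Buf τ × ς)} {s t : ℕ} {x y z : List (Sym τ)}
    (h : F.Computes w s x y) (h' : G.Computes w t y z) : (F.seq G).Computes w (s + t) x z :=
  fun r => (h r).seq (h' r)

/-- Symbols below the argument are not touched. -/
theorem Computes.frame {F : Frag (stkΓ τ Γ) (Buf τ × ς)} {t : ℕ} {x y : List (Sym τ)}
    (h : F.Computes w t x y) (z : List (Sym τ)) : F.Computes w t (x ++ z) (y ++ z) := fun r => by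
  simpa only [List.append_assoc] using h (z ++ r)

/-- Duplicate the topmost term. -/
def dup : Frag (stkΓ τ Γ) (Buf τ × ς) :=
  (moveTerm .a).seq ((moveBoth .a .main .b).seq ((moveAll .b .a).seq (moveAll .a .main)))

/-- Each transfer between stacks reverses the order of symbols. Both copies are poured an even
number of times, so they end up in the original order. -/
theorem computes_dup (x : Val τ) :
    (dup (Γ := Γ)).Computes w (4 * x.code.length + 5) x.code (x.code ++ x.code) := fun r => by
  have h1 := runs_moveTerm (Γ := Γ) (dst := .a)
    (mk := fun c m d => store { main := m, a := d, c := c } fun _ => [])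
    (fun m d => ⟨fun l => by simp, fun l l' => by simp⟩)
    (fun m d => ⟨fun l => by simp, fun l l' => by simp⟩)
    (fun m d => ⟨fun l => by simp, fun l l' => by simp⟩) x r [] w
  have h2 := runs_moveBoth (Γ := Γ) (src := .a) (dst := .main) (dst' := .b)
    (mk := fun s d e => store { main := d, a := s, b := e } fun _ => [])
    (fun m d => ⟨fun l => by simp, fun l l' => by simp⟩)
    (fun m d => ⟨fun l => by simp, fun l l' => by simp⟩)
    (fun m d => ⟨fun l => by simp, fun l l' => by simp⟩) (x.code.reverse) r [] (none, none) w
  have h3 := runs_moveAll (Γ := Γ) (src := .b) (dst := .a)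
    (mk := fun s d => store { main := x.code ++ r, a := d, b := s } fun _ => [])
    (fun m => ⟨fun l => by simp, fun l l' => by simp⟩)
    (fun m => ⟨fun l => by simp, fun l l' => by simp⟩) x.code [] (none, none) w
  have h4 := runs_moveAll (Γ := Γ) (src := .a) (dst := .main)
    (mk := fun s d => store { main := d, a := s } fun _ => [])
    (fun m => ⟨fun l => by simp, fun l l' => by simp⟩)
    (fun m => ⟨fun l => by simp, fun l l' => by simp⟩) x.code.reverse (x.code ++ r) (none, none) w
  simp only [List.reverse_reverse, List.append_nil, List.length_reverse] at h1 h2 h3 h4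
  rw [List.append_assoc]
  exact (h1.seq (h2.seq (h3.seq h4))).mono (by omega)

/-- Exchange the two topmost terms. -/
def swap : Frag (stkΓ τ Γ) (Buf τ × ς) :=
  (moveTerm .a).seq ((moveTerm .b).seq ((moveAll .a .main).seq (moveAll .b .main)))

theorem computes_swap (x y : Val τ) :
    (swap (Γ := Γ)).Computes w (2 * x.code.length + 2 * y.code.length + 6) (x.code ++ y.code)
      (y.code ++ x.code) := fun r => by
  have h1 := runs_moveTerm (Γ := Γ) (dst := .a)
    (mk := fun c m d => store { main := m, a := d, c := c } fun _ => [])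
    (fun m d => ⟨fun l => by simp, fun l l' => by simp⟩)
    (fun m d => ⟨fun l => by simp, fun l l' => by simp⟩)
    (fun m d => ⟨fun l => by simp, fun l l' => by simp⟩) x (y.code ++ r) [] w
  have h2 := runs_moveTerm (Γ := Γ) (dst := .b)
    (mk := fun c m d =>
      store { main := m, a := x.code.reverse, b := d, c := c } fun _ => [])
    (fun m d => ⟨fun l => by simp, fun l l' => by simp⟩)
    (fun m d => ⟨fun l => by simp, fun l l' => by simp⟩)
    (fun m d => ⟨fun l => by simp, fun l l' => by simp⟩) y r [] w
  have h3 := runs_moveAll (Γ := Γ) (src := .a) (dst := .main)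
    (mk := fun s d => store { main := d, a := s, b := y.code.reverse } fun _ => [])
    (fun m => ⟨fun l => by simp, fun l l' => by simp⟩)
    (fun m => ⟨fun l => by simp, fun l l' => by simp⟩) x.code.reverse r (none, none) w
  have h4 := runs_moveAll (Γ := Γ) (src := .b) (dst := .main)
    (mk := fun s d => store { main := d, b := s } fun _ => [])
    (fun m => ⟨fun l => by simp, fun l l' => by simp⟩)
    (fun m => ⟨fun l => by simp, fun l l' => by simp⟩) y.code.reverse (x.code ++ r) (none, none) w
  simp only [List.reverse_reverse, List.append_nil, List.length_reverse] at h1 h2 h3 h4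
  simp only [List.append_assoc]
  exact (h1.seq (h2.seq (h3.seq h4))).mono (by omega)

/-- Remove the topmost term. -/
def drop : Frag (stkΓ τ Γ) (Buf τ × ς) := (moveTerm .a).seq (clear .a)

theorem computes_drop (x : Val τ) :
    (drop (Γ := Γ)).Computes w (2 * x.code.length + 3) x.code [] := fun r => by
  have h1 := runs_moveTerm (Γ := Γ) (dst := .a)
    (mk := fun c m d => store { main := m, a := d, c := c } fun _ => [])
    (fun m d => ⟨fun l => by simp, fun l l' => by simp⟩)
    (fun m d => ⟨fun l => by simp, fun l l' => by simp⟩)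
    (fun m d => ⟨fun l => by simp, fun l l' => by simp⟩) x r [] w
  have h2 := runs_clear (Γ := Γ) (src := .a)
    (mk := fun s => store { main := r, a := s } fun _ => [])
    ⟨fun l => by simp, fun l l' => by simp⟩ x.code.reverse (none, none) w
  simp only [List.append_nil, List.length_reverse] at h1 h2
  exact (h1.seq h2).mono (by omega)

/-- Exchange the second and the third term. -/
def rotate : Frag (stkΓ τ Γ) (Buf τ × ς) :=
  (moveTerm .a).seq ((moveTerm .b).seq ((moveTerm .d).seq ((moveAll .b .main).seq
    ((moveAll .d .main).seq (moveAll .a .main)))))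

/-- This brings element, tail and state into the order element, state, tail, as needed by the loop
body of `PT.computes_foldl`. -/
theorem computes_rotate (x y z : Val τ) :
    (rotate (Γ := Γ)).Computes w
      (2 * x.code.length + 2 * y.code.length + 2 * z.code.length + 9)
      (x.code ++ (y.code ++ z.code)) (x.code ++ (z.code ++ y.code)) := fun r => by
  have h1 := runs_moveTerm (Γ := Γ) (dst := .a)
    (mk := fun c m d => store { main := m, a := d, c := c } fun _ => [])
    (fun m d => ⟨fun l => by simp, fun l l' => by simp⟩)
    (fun m d => ⟨fun l => by simp, fun l l' => by simp⟩)
    (fun m d => ⟨fun l => by simp, fun l l' => by simp⟩) x (y.code ++ (z.code ++ r)) [] w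
  have h2 := runs_moveTerm (Γ := Γ) (dst := .b)
    (mk := fun c m d =>
      store { main := m, a := x.code.reverse, b := d, c := c } fun _ => [])
    (fun m d => ⟨fun l => by simp, fun l l' => by simp⟩)
    (fun m d => ⟨fun l => by simp, fun l l' => by simp⟩)
    (fun m d => ⟨fun l => by simp, fun l l' => by simp⟩) y (z.code ++ r) [] w
  have h3 := runs_moveTerm (Γ := Γ) (dst := .d)
    (mk := fun c m d =>
      store { main := m, a := x.code.reverse, b := y.code.reverse, d := d, c := c }
      fun _ => [])
    (fun m d => ⟨fun l => by simp, fun l l' => by simp⟩)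
    (fun m d => ⟨fun l => by simp, fun l l' => by simp⟩)
    (fun m d => ⟨fun l => by simp, fun l l' => by simp⟩) z r [] w
  have h4 := runs_moveAll (Γ := Γ) (src := .b) (dst := .main)
    (mk := fun s d => store { main := d, a := x.code.reverse, b := s, d := z.code.reverse }
      fun _ => [])
    (fun m => ⟨fun l => by simp, fun l l' => by simp⟩)
    (fun m => ⟨fun l => by simp, fun l l' => by simp⟩) y.code.reverse r (none, none) w
  have h5 := runs_moveAll (Γ := Γ) (src := .d) (dst := .main)
    (mk := fun s d => store { main := d, a := x.code.reverse, d := s } fun _ => [])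
    (fun m => ⟨fun l => by simp, fun l l' => by simp⟩)
    (fun m => ⟨fun l => by simp, fun l l' => by simp⟩) z.code.reverse (y.code ++ r) (none, none) w
  have h6 := runs_moveAll (Γ := Γ) (src := .a) (dst := .main)
    (mk := fun s d => store { main := d, a := s } fun _ => [])
    (fun m => ⟨fun l => by simp, fun l l' => by simp⟩)
    (fun m => ⟨fun l => by simp, fun l l' => by simp⟩) x.code.reverse (z.code ++ (y.code ++ r))
    (none, none) w
  simp only [List.reverse_reverse, List.append_nil, List.length_reverse] at h1 h2 h3 h4 h5 h6
  simp only [List.append_assoc]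
  exact (h1.seq (h2.seq (h3.seq (h4.seq (h5.seq h6))))).mono (by omega)

/-- Perform a statement without repetition. -/
theorem computes_single {q : TM2.Stmt (stkΓ τ Γ) Unit (Buf τ × ς)} {x y : List (Sym τ)}
    (h : ∀ r, TM2.stepAux q ((none, none), w) (store { main := x ++ r } fun _ => []) =
      ⟨none, ((none, none), w), store { main := y ++ r } fun _ => []⟩) :
    (single q).Computes w 1 x y := fun r => runs_single (h r)

/-- Push the topmost symbol `cons`. -/
def pushCons : Frag (stkΓ τ Γ) (Buf τ × ς) := single (pushSym .main .cons .halt)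

theorem computes_pushCons (x : List (Sym τ)) :
    (pushCons (Γ := Γ)).Computes w 1 x (.cons :: x) :=
  computes_single fun r => by simp [pushSym]

/-- Pop a symbol. -/
def pop : Frag (stkΓ τ Γ) (Buf τ × ς) := single (popTo .main done)

theorem computes_pop (s : Sym τ) (x : List (Sym τ)) :
    (pop (Γ := Γ)).Computes w 1 (s :: x) x :=
  computes_single fun r => by simp [popTo, done]

/-- Push a list of symbols. -/
def pushAllStmt (l : List (Sym τ)) : TM2.Stmt (stkΓ τ Γ) Unit (Buf τ × ς) :=
  l.foldr (fun s q => pushSym .main s q) .halt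

theorem stepAux_pushAllStmt (l x : List (Sym τ)) (v : Buf τ) :
    TM2.stepAux (pushAllStmt (Γ := Γ) l) (v, w) (store { main := x } fun _ => []) =
      ⟨none, (v, w), store { main := l.reverse ++ x } fun _ => []⟩ := by
  induction l generalizing x with
  | nil => rfl
  | cons s l ih => simpa [pushAllStmt, pushSym] using ih (s :: x)

/-- Push a constant. -/
def pushVal (x : Val τ) : Frag (stkΓ τ Γ) (Buf τ × ς) := single (pushAllStmt x.code.reverse)

theorem computes_pushVal (x : Val τ) : (pushVal (Γ := Γ) x).Computes w 1 [] x.code :=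
  computes_single fun r => by simpa using stepAux_pushAllStmt x.code.reverse r (none, none)

/-- Pop a symbol and go on according to whether it is `cons`. -/
def caseCons (F G : Frag (stkΓ τ Γ) (Buf τ × ς)) : Frag (stkΓ τ Γ) (Buf τ × ς) :=
  ite (popTo .main <| .branch (fun v => v.1.isCons)
    (.load (fun v => ((none, none), v.2)) <| .goto fun _ => true)
    (.load (fun v => ((none, none), v.2)) <| .goto fun _ => false)) F G

theorem computes_caseCons_cons {F G : Frag (stkΓ τ Γ) (Buf τ × ς)} {t : ℕ} {x y : List (Sym τ)}
    (h : F.Computes w t x y) : (caseCons F G).Computes w (t + 1) (.cons :: x) y := fun r =>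
  runs_ite (b := true) (by simp [popTo, Buf.isCons]) (h r)

theorem computes_caseCons_nil {F G : Frag (stkΓ τ Γ) (Buf τ × ς)} {t : ℕ} {x y : List (Sym τ)}
    (h : G.Computes w t x y) : (caseCons F G).Computes w (t + 1) (.nil :: x) y := fun r =>
  runs_ite (b := false) (by simp [popTo, Buf.isCons]) (h r)

/-- While a symbol `cons` can be popped, perform `F`. -/
def whileCons (F : Frag (stkΓ τ Γ) (Buf τ × ς)) : Frag (stkΓ τ Γ) (Buf τ × ς) :=
  loop (popTo .main <| .branch (fun v => v.1.isCons)
    (.load (fun v => ((none, none), v.2)) again) done) F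

theorem computes_whileCons_nil {F : Frag (stkΓ τ Γ) (Buf τ × ς)} (x : List (Sym τ)) :
    (whileCons F).Computes w 1 (.nil :: x) x := fun r =>
  runs_loop (by simp [popTo, Buf.isCons, done])

theorem computes_whileCons_cons {F : Frag (stkΓ τ Γ) (Buf τ × ς)} {s t : ℕ}
    {x y z : List (Sym τ)} (h : F.Computes w s x y) (h' : (whileCons F).Computes w t y z) :
    (whileCons F).Computes w (s + t + 1) (.cons :: x) z := fun r =>
  runs_loop_again (by simp [popTo, Buf.isCons, again]) (h r) (h' r)

/-- Compare the two topmost terms, which are letters. -/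
def cmpTok (f : τ → τ → Bool) : Frag (stkΓ τ Γ) (Buf τ × ς) :=
  single <| popTo .main <| .pop (.reg .main) (fun v s => ((v.1.1, s), v.2)) <|
    .branch (fun v => match v.1 with
      | (some (.tok a), some (.tok b)) => f a b
      | _ => false)
    (pushSym .main .nil <| pushSym .main .nil <| pushSym .main .cons done)
    (pushSym .main .nil done)

theorem computes_cmpTok (f : τ → τ → Bool) (a b : τ) :
    (cmpTok (Γ := Γ) f).Computes w 1 [.tok a, .tok b]
      (cond (f a b) [.cons, .nil, .nil] [.nil]) :=
  computes_single fun r => by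
    cases h : f a b <;> simp [popTo, pushSym, done, h]

end Frag

end Basic

/-! ## Calling a subroutine, input and output -/

section Sub

variable {τ K : Type} [DecidableEq K] {Γ : K → Type} {Λ ς : Type}

/-- A statement of a subroutine, acting on its own stacks and state. -/
def liftStmt : TM2.Stmt Γ Λ ς → TM2.Stmt (stkΓ τ Γ) Λ (Buf τ × ς)
  | .push k g q => .push (.sub k) (fun v => g v.2) (liftStmt q)
  | .peek k g q => .peek (.sub k) (fun v s => (v.1, g v.2 s)) (liftStmt q)
  | .pop k g q => .pop (.sub k) (fun v s => (v.1, g v.2 s)) (liftStmt q)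
  | .load g q => .load (fun v => (v.1, g v.2)) (liftStmt q)
  | .branch g q q' => .branch (fun v => g v.2) (liftStmt q) (liftStmt q')
  | .goto g => .goto fun v => g v.2
  | .halt => .halt

/-- A configuration of a subroutine as part of the whole configuration. -/
def liftCfg (v : Buf τ) (M : Mem τ) (c : TM2.Cfg Γ Λ ς) : TM2.Cfg (stkΓ τ Γ) Λ (Buf τ × ς) :=
  ⟨c.l, (v, c.var), store M c.stk⟩

theorem stepAux_liftStmt (v : Buf τ) (M : Mem τ) (q : TM2.Stmt Γ Λ ς) (w : ς)
    (S : ∀ k, List (Γ k)) :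
    TM2.stepAux (liftStmt q) (v, w) (store M S) = liftCfg v M (TM2.stepAux q w S) := by
  induction q generalizing w S with
  | push _ _ _ ih | peek _ _ _ ih | pop _ _ _ ih | load _ _ ih =>
    simp only [liftStmt, TM2.stepAux, store_update_sub, store_sub, ih]
  | branch g q q' ih ih' => cases hg : g w <;> simp [liftStmt, TM2.stepAux, hg, ih, ih']
  | goto => rfl
  | halt => rfl

theorem Steps.lift {m : Λ → TM2.Stmt Γ Λ ς} {n : ℕ} {c c' : TM2.Cfg Γ Λ ς} (h : Steps m n c c')
    (v : Buf τ) (M : Mem τ) :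
    Steps (fun l => liftStmt (m l)) n (liftCfg v M c) (liftCfg v M c') := by
  induction n generalizing c with
  | zero => cases h; rfl
  | succ n ih =>
    obtain ⟨d, hd, h⟩ := h
    obtain ⟨_ | l, w, S⟩ := c
    · simp at hd
    · refine ⟨_, ?_, ih h⟩
      simp only [TM2.step, Option.some.injEq] at hd
      rw [← hd, ← stepAux_liftStmt]
      rfl

end Sub

namespace Frag

/-- The prefix notation of a list of letters. -/
def _root_.UTA.codeList {τ : Type} (l : List τ) : List (Sym τ) :=
  l.foldr (fun a x => .cons :: .tok a :: x) [.nil]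

section InputOutput

variable {τ K : Type} [DecidableEq K] {Γ : K → Type} {ς : Type}

/-- Move the letters of a list from `main` to `a`. -/
def unpack : Frag (stkΓ τ Γ) (Buf τ × ς) :=
  single <| popTo .main <| .branch (fun v => v.1.isCons)
    (popTo .main <| pushFrom .a again) done

theorem runs_unpack (l : List τ) (r A : List (Sym τ)) (v : Buf τ) (w : ς) :
    (unpack (Γ := Γ)).Runs (l.length + 1)
      ((v, w), store { main := codeList l ++ r, a := A } fun _ => [])
      (((none, none), w), store { main := r, a := (l.map Sym.tok).reverse ++ A } fun _ => []) := by
  induction l generalizing A v with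
  | nil => exact runs_single (by simp [popTo, done, codeList, Buf.isCons])
  | cons b l ih =>
    refine runs_single_again ?_ (by simpa [unpack] using ih (.tok b :: A) (some (.tok b), none))
    simp [popTo, pushFrom, again, codeList, Buf.isCons]

/-- Move the input to `a`. -/
def readInput : Frag (stkΓ τ Γ) (Buf τ × ς) :=
  single <| .pop .inp (fun v s => ((s.map .tok, none), v.2)) <|
    .branch (fun v => v.1.1.isSome) (pushFrom .a again) done

theorem runs_readInput (l : List τ) (A : List (Sym τ)) (v : Buf τ) (w : ς) :
    (readInput (Γ := Γ)).Runs (l.length + 1)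
      ((v, w), store { inp := l, a := A } fun _ => [])
      (((none, none), w), store { a := (l.map Sym.tok).reverse ++ A } fun _ => []) := by
  induction l generalizing A v with
  | nil => exact runs_single (by simp [done])
  | cons b l ih =>
    refine runs_single_again ?_ (by simpa [readInput] using ih (.tok b :: A) (some (.tok b), none))
    simp [pushFrom, again]

/-- Build a list on `main` from the letters on `a`. -/
def pack : Frag (stkΓ τ Γ) (Buf τ × ς) :=
  single <| popTo .a <| .branch (fun v => v.1.1.isSome)
    (pushFrom .main <| pushSym .main .cons again) done

theorem runs_pack (l l' : List τ) (v : Buf τ) (w : ς) :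
    (pack (Γ := Γ)).Runs (l.length + 1)
      ((v, w), store { main := codeList l', a := l.map Sym.tok } fun _ => [])
      (((none, none), w), store { main := codeList (l.reverse ++ l') } fun _ => []) := by
  induction l generalizing l' v with
  | nil => exact runs_single (by simp [done, popTo])
  | cons b l ih =>
    refine runs_single_again ?_ (by simpa [pack] using ih (b :: l') (some (.tok b), none))
    simp [popTo, pushFrom, pushSym, again, codeList]

/-- Convert the input to a list on `main`. -/
def loadInput : Frag (stkΓ τ Γ) (Buf τ × ς) :=
  readInput.seq ((single (pushSym .main .nil .halt)).seq pack)

theorem runs_loadInput (l : List τ) (w : ς) :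
    (loadInput (Γ := Γ)).Runs (2 * l.length + 3)
      (((none, none), w), store { inp := l } fun _ => [])
      (((none, none), w), store { main := codeList l } fun _ => []) := by
  have h1 := runs_readInput (Γ := Γ) l [] (none, none) w
  have h2 := runs_pack (Γ := Γ) l.reverse [] (none, none) w
  simp only [List.append_nil, List.reverse_reverse, List.length_reverse] at h1 h2
  refine (h1.seq (Runs.seq (runs_single (S' := store
    { main := codeList [], a := l.reverse.map Sym.tok } fun _ => []) ?_) h2)).mono (by omega)
  simp [pushSym, codeList]

/-- Convert a Boolean on `main` to the output. -/
def storeOutput : Frag (stkΓ τ Γ) (Buf τ × ς) :=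
  single <| popTo .main <| .branch (fun v => v.1.isCons)
    (popTo .main <| popTo .main <| .push .out (fun _ => true) done)
    (.push .out (fun _ => false) done)

theorem runs_storeOutput (b : Bool) (w : ς) :
    (storeOutput (τ := τ) (Γ := Γ)).Runs 1
      (((none, none), w), store { main := cond b [.cons, .nil, .nil] [.nil] } fun _ => [])
      (((none, none), w), store { out := [b] } fun _ => []) := by
  cases b <;> exact runs_single (by simp [popTo, done, Buf.isCons])

end InputOutput

section Oracle

variable {τ : Type} (O : TM2ComputableAux τ Bool)

/-- The stack alphabets of programs with subroutine `O`. -/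
abbrev _root_.UTA.OΓ : Stk O.tm.K → Type := stkΓ τ O.tm.Γ

/-- The states of programs with subroutine `O`. -/
abbrev _root_.UTA.Oσ : Type := Buf τ × O.tm.σ

/-- Move the letters on `a` to the input stack of the subroutine. -/
def feed [Inhabited τ] : Frag (OΓ O) (Oσ O) :=
  single <| popTo .a <| .branch (fun v => v.1.1.isSome)
    (.push (.sub O.tm.k₀) (fun v => O.inputAlphabet.symm
      (match v.1.1 with
        | some (.tok a) => a
        | _ => default)) again) done

theorem runs_feed [Inhabited τ] (l l' : List τ) (r : List (Sym τ)) (v : Buf τ) (w : O.tm.σ) :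
    (feed O).Runs (l.length + 1)
      ((v, w), store { main := r, a := l.map Sym.tok }
        (Function.update (fun _ => []) O.tm.k₀ (l'.map O.inputAlphabet.symm)))
      (((none, none), w), store { main := r }
        (Function.update (fun _ => []) O.tm.k₀ ((l.reverse ++ l').map O.inputAlphabet.symm))) := by
  induction l generalizing l' v with
  | nil => exact runs_single (by simp [done, popTo])
  | cons b l ih =>
    refine runs_single_again ?_ (by simpa [feed] using ih (b :: l') (some (.tok b), none))
    simp [popTo, again]

/-- The subroutine itself. -/
def sub : Frag (OΓ O) (Oσ O) := ⟨O.tm.Λ, O.tm.ΛFin, O.tm.main, fun l => liftStmt (O.tm.m l)⟩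

theorem initList_eq (l : List (O.tm.Γ O.tm.k₀)) :
    initList O.tm l =
      ⟨some O.tm.main, O.tm.initialState, Function.update (fun _ => []) O.tm.k₀ l⟩ := by
  unfold initList
  congr 1
  funext k
  by_cases h : k = O.tm.k₀
  · subst h; simp
  · simp [h]

theorem haltList_eq (l : List (O.tm.Γ O.tm.k₁)) :
    haltList O.tm l = ⟨none, O.tm.initialState, Function.update (fun _ => []) O.tm.k₁ l⟩ := by
  unfold haltList
  congr 1
  funext k
  by_cases h : k = O.tm.k₁
  · subst h; simp
  · simp [h]

/-- The output convention of `TM2OutputsInTime` requires the initial internal state and empty stacks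
apart from the output at the end. Once the output is fetched, the subroutine is ready for the next
call. -/
theorem runs_sub {l : List (O.tm.Γ O.tm.k₀)} {l' : List (O.tm.Γ O.tm.k₁)} {t : ℕ}
    (h : TM2OutputsInTime O.tm l (some l') t) (M : Mem τ) :
    (sub O).Runs t (((none, none), O.tm.initialState),
        store M (Function.update (fun _ => []) O.tm.k₀ l))
      (((none, none), O.tm.initialState),
        store M (Function.update (fun _ => []) O.tm.k₁ l')) := by
  obtain ⟨⟨n, h⟩, hn⟩ := h
  refine ⟨n, hn, ?_⟩
  rw [Option.map_some, haltList_eq, initList_eq] at h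
  exact (steps_iff_iterate.2 h).lift (none, none) M

/-- Move the output of the subroutine to `main`. -/
def fetch : Frag (OΓ O) (Oσ O) :=
  single <| .pop (.sub O.tm.k₁)
    (fun v s => ((s.map fun s => cond (O.outputAlphabet s) .cons .nil, none), v.2)) <|
    .branch (fun v => v.1.isCons)
    (pushSym .main .nil <| pushSym .main .nil <| pushSym .main .cons done)
    (pushSym .main .nil done)

theorem runs_fetch (b : Bool) (r : List (Sym τ)) (w : O.tm.σ) :
    (fetch O).Runs 1 (((none, none), w), store { main := r }
        (Function.update (fun _ => []) O.tm.k₁ [O.outputAlphabet.symm b]))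
      (((none, none), w), store { main := cond b [.cons, .nil, .nil] [.nil] ++ r }
        fun _ => []) := by
  cases b <;> exact runs_single (by simp [pushSym, done, Buf.isCons])

/-- Call the subroutine on a list of letters. -/
def call [Inhabited τ] : Frag (OΓ O) (Oσ O) := unpack.seq ((feed O).seq ((sub O).seq (fetch O)))

/-- Unpacking and feeding each reverse the list of letters, so the subroutine sees it in the right
order. -/
theorem computes_call [Inhabited τ] {l : List τ} {b : Bool} {t : ℕ}
    (h : TM2OutputsInTime O.tm (l.map O.inputAlphabet.symm)
      (some [O.outputAlphabet.symm b]) t) :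
    (call O).Computes O.tm.initialState (2 * l.length + t + 3) (codeList l)
      (cond b [.cons, .nil, .nil] [.nil]) := fun r => by
  have h1 := runs_unpack (Γ := O.tm.Γ) l r [] (none, none) O.tm.initialState
  have h2 := runs_feed O l.reverse [] r (none, none) O.tm.initialState
  simp only [List.append_nil, List.reverse_reverse, List.length_reverse, List.map_nil,
    Function.update_eq_self, List.map_reverse] at h1 h2
  exact (h1.seq (h2.seq ((runs_sub O h _).seq (runs_fetch O b r _)))).mono (by omega)

end Oracle

end Frag

/-! ## Functions computable in polynomial time on binary trees -/

/-- Representations of objects by binary trees with leaves in `τ`. -/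
class Enc (τ A : Type) where
  enc : A → Val τ

section Enc

variable {τ A B : Type}

instance : Enc τ τ := ⟨.tok⟩

instance : Enc τ Bool := ⟨fun b => cond b (.cons .nil .nil) .nil⟩

instance [Enc τ A] [Enc τ B] : Enc τ (A × B) := ⟨fun x => .cons (Enc.enc x.1) (Enc.enc x.2)⟩

instance [Enc τ A] : Enc τ (List A) := ⟨fun l => l.foldr (fun a x => .cons (Enc.enc a) x) .nil⟩

instance [Enc τ A] : Enc τ (Option A) :=
  ⟨fun o => o.elim .nil fun a => .cons (Enc.enc a) .nil⟩

variable (τ)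

/-- The prefix notation of the representation of `a`. -/
def code [Enc τ A] (a : A) : List (Sym τ) := (Enc.enc a : Val τ).code

/-- The size of the representation of `a`. -/
def sz [Enc τ A] (a : A) : ℕ := (code τ a).length

theorem length_code [Enc τ A] (a : A) : (code τ a).length = sz τ a := rfl

@[simp] theorem code_tok (a : τ) : code τ a = [.tok a] := rfl

@[simp] theorem code_prod [Enc τ A] [Enc τ B] (x : A × B) :
    code τ x = .cons :: (code τ x.1 ++ code τ x.2) := rfl

@[simp] theorem code_cons [Enc τ A] (a : A) (l : List A) :
    code τ (a :: l) = .cons :: (code τ a ++ code τ l) := rfl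

@[simp] theorem sz_tok (a : τ) : sz τ a = 1 := rfl

@[simp] theorem sz_true : sz τ true = 3 := rfl

@[simp] theorem sz_false : sz τ false = 1 := rfl

theorem sz_bool (b : Bool) : sz τ b ≤ 3 := by cases b <;> simp

@[simp] theorem sz_prod [Enc τ A] [Enc τ B] (x : A × B) :
    sz τ x = sz τ x.1 + sz τ x.2 + 1 := by
  simp [sz]

@[simp] theorem sz_nil [Enc τ A] : sz τ ([] : List A) = 1 := rfl

@[simp] theorem sz_cons [Enc τ A] (a : A) (l : List A) :
    sz τ (a :: l) = sz τ a + sz τ l + 1 := by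
  simp [sz]

@[simp] theorem sz_none [Enc τ A] : sz τ (none : Option A) = 1 := rfl

@[simp] theorem sz_some [Enc τ A] (a : A) : sz τ (some a) = sz τ a + 2 := by
  change (Val.code (.cons (Enc.enc a) .nil)).length = _
  simp [sz, code, Val.code]

theorem length_lt_sz [Enc τ A] (l : List A) : l.length < sz τ l := by
  induction l with
  | nil => simp
  | cons a l ih => simp; omega

theorem sz_append [Enc τ A] (l l' : List A) : sz τ (l ++ l') + 1 = sz τ l + sz τ l' := by
  induction l with
  | nil => simp; omega
  | cons a l ih => simp; omega

theorem code_list (l : List τ) : code τ l = codeList l := by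
  induction l with
  | nil => rfl
  | cons a l ih => simp [codeList, ih]

theorem sz_toks (l : List τ) : sz τ l = 2 * l.length + 1 := by
  induction l with
  | nil => rfl
  | cons a l ih => simp [ih]; omega

end Enc

theorem poly_mono (p : Polynomial ℕ) {m n : ℕ} (h : m ≤ n) : p.eval m ≤ p.eval n := by
  rw [Polynomial.eval_eq_sum_range, Polynomial.eval_eq_sum_range]
  gcongr

/-- `f` is computed by a program with subroutine `O` in polynomial time, and the size of its values
is bounded by a polynomial. -/
def PT {τ A B : Type} (O : TM2ComputableAux τ Bool) [Enc τ A] [Enc τ B] (f : A → B) : Prop :=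
  ∃ (F : Frag (OΓ O) (Oσ O)) (p : Polynomial ℕ), ∀ a, sz τ (f a) ≤ p.eval (sz τ a) ∧
    F.Computes O.tm.initialState (p.eval (sz τ a)) (code τ a) (code τ (f a))

/-! ### Closure properties of the class of polynomial-time functions -/

namespace PT

open Frag

variable {τ A B C D E S G : Type} [Enc τ A] [Enc τ B] [Enc τ C] [Enc τ D] [Enc τ E] [Enc τ S]
  [Enc τ G] {O : TM2ComputableAux τ Bool}

theorem dup_code (a : A) : (dup (Γ := O.tm.Γ)).Computes O.tm.initialState (4 * sz τ a + 5)
    (code τ a) (code τ a ++ code τ a) := computes_dup _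

theorem swap_code (a : A) (b : B) : (swap (Γ := O.tm.Γ)).Computes O.tm.initialState
    (2 * sz τ a + 2 * sz τ b + 6) (code τ a ++ code τ b) (code τ b ++ code τ a) :=
  computes_swap _ _

theorem drop_code (a : A) : (drop (Γ := O.tm.Γ)).Computes O.tm.initialState (2 * sz τ a + 3)
    (code τ a) [] := computes_drop _

theorem rotate_code (a : A) (b : B) (c : C) : (rotate (Γ := O.tm.Γ)).Computes O.tm.initialState
    (2 * sz τ a + 2 * sz τ b + 2 * sz τ c + 9) (code τ a ++ (code τ b ++ code τ c))
    (code τ a ++ (code τ c ++ code τ b)) := computes_rotate _ _ _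

/-- Size and time may be bounded by different polynomials; their sum bounds both. -/
theorem intro {f : A → B} (F : Frag (OΓ O) (Oσ O)) (p q : Polynomial ℕ)
    (hp : ∀ a, sz τ (f a) ≤ p.eval (sz τ a))
    (hq : ∀ a, F.Computes O.tm.initialState (q.eval (sz τ a)) (code τ a) (code τ (f a))) :
    PT O f :=
  ⟨F, p + q, fun a => ⟨by rw [Polynomial.eval_add]; exact (hp a).trans (Nat.le_add_right _ _),
    (hq a).mono (by rw [Polynomial.eval_add]; exact Nat.le_add_left _ _)⟩⟩

/-- The size bound in `PT` is what makes this work: `g` runs on an argument of size at most `p`,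
hence in time `q ∘ p`. -/
theorem comp {g : B → C} {f : A → B} (hg : PT O g) (hf : PT O f) : PT O fun a => g (f a) := by
  obtain ⟨F, p, hF⟩ := hf
  obtain ⟨G, q, hG⟩ := hg
  refine intro (F.seq G) (q.comp p) (p + q.comp p) (fun a => ?_) fun a => ?_
  · rw [Polynomial.eval_comp]
    exact (hG _).1.trans (poly_mono q (hF a).1)
  · rw [Polynomial.eval_add, Polynomial.eval_comp]
    exact (hF a).2.seq ((hG _).2.mono (poly_mono q (hF a).1))

/-- A function that agrees with `g` on the level of representations. -/
theorem of_enc {g : B → C} (hg : PT O g) {f : A → D} (i : A → B)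
    (hi : ∀ a, (Enc.enc a : Val τ) = Enc.enc (i a))
    (ho : ∀ a, (Enc.enc (f a) : Val τ) = Enc.enc (g (i a))) : PT O f := by
  obtain ⟨F, p, hF⟩ := hg
  refine ⟨F, p, fun a => ?_⟩
  have h := hF (i a)
  simp only [sz, code] at h ⊢
  rw [hi, ho]
  exact h

/-- A function that does not change the representation. -/
theorem cast {f : A → B} (h : ∀ a, (Enc.enc (f a) : Val τ) = Enc.enc a) : PT O f := by
  refine ⟨single .halt, Polynomial.X + 1, fun a => ⟨?_, ?_⟩⟩
  · simp [sz, code, h]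
  · have : code τ (f a) = code τ a := congrArg Val.code (h a)
    rw [this]
    exact (computes_single fun r => rfl).mono (by simp)

theorem id : PT O fun a : A => a := cast fun _ => rfl

theorem const (b : B) : PT O fun _ : A => b := by
  refine intro (drop.seq (pushVal (Enc.enc b))) (Polynomial.C (sz τ b))
    (2 * Polynomial.X + 4) (fun a => by simp) fun a => ?_
  refine ((drop_code a).seq (computes_pushVal _)).mono ?_
  simp

theorem fst : PT O fun x : A × B => x.1 := by
  refine intro (pop.seq (swap.seq drop)) Polynomial.X (4 * Polynomial.X + 20)
    (fun a => by simp; omega) fun a => ?_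
  refine ((computes_pop _ _).seq ((swap_code a.1 a.2).seq
    ((drop_code a.2).frame _))).mono ?_
  simp; omega

theorem snd : PT O fun x : A × B => x.2 := by
  refine intro (pop.seq drop) Polynomial.X (4 * Polynomial.X + 20)
    (fun a => by simp; omega) fun a => ?_
  refine ((computes_pop _ _).seq ((drop_code a.1).frame _)).mono ?_
  simp; omega

theorem pair {f : A → B} {g : A → C} (hf : PT O f) (hg : PT O g) :
    PT O fun a => (f a, g a) := by
  obtain ⟨F, p, hF⟩ := hf
  obtain ⟨G, q, hG⟩ := hg
  refine intro (dup.seq (F.seq (swap.seq (G.seq (swap.seq pushCons))))) (p + q + 1)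
    (6 * Polynomial.X + 5 * p + 3 * q + 20) (fun a => ?_) fun a => ?_
  · simpa using Nat.add_le_add (hF a).1 (hG a).1
  · have h1 := (hF a).1
    have h2 := (hG a).1
    refine ((dup_code a).seq (((hF a).2.frame _).seq
      ((swap_code (f a) a).seq (((hG a).2.frame _).seq
        ((swap_code (g a) (f a)).seq (computes_pushCons _)))))).mono ?_
    simp at h1 h2 ⊢
    omega

theorem ite {c : A → Bool} {f g : A → B} (hc : PT O c) (hf : PT O f) (hg : PT O g) :
    PT O fun a => if c a then f a else g a := by
  obtain ⟨Fc, r, hFc⟩ := hc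
  obtain ⟨F, p, hF⟩ := hf
  obtain ⟨G, q, hG⟩ := hg
  -- The representation of `true` is `cons nil nil`. The case distinction consumes the `cons`, and
  -- the two pops remove the leaves; `false` is a single `nil`, consumed entirely.
  refine intro (dup.seq (Fc.seq (caseCons (pop.seq (pop.seq F)) G))) (p + q)
    (4 * Polynomial.X + r + p + q + 20) (fun a => ?_) fun a => ?_
  · have h1 := (hF a).1
    have h2 := (hG a).1
    rw [Polynomial.eval_add]
    split_ifs <;> omega
  · have h : (caseCons (pop.seq (pop.seq F)) G).Computes O.tm.initialState
        (p.eval (sz τ a) + q.eval (sz τ a) + 3) (code τ (c a) ++ code τ a)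
        (code τ (if c a then f a else g a)) := by
      cases hca : c a
      · exact (computes_caseCons_nil (hG a).2).mono (by omega)
      · exact (computes_caseCons_cons ((computes_pop _ _).seq
          ((computes_pop _ _).seq (hF a).2))).mono (by omega)
    refine ((dup_code a).seq (((hFc a).2.frame _).seq h)).mono ?_
    simp; omega

/-- Case distinction on a list. -/
theorem listCase {l : A → List B} {f : A → C} {g : (B × List B) × A → C} (hl : PT O l)
    (hf : PT O f) (hg : PT O g) :
    PT O fun a => match l a with
      | [] => f a
      | b :: bs => g ((b, bs), a) := by
  obtain ⟨Fl, r, hFl⟩ := hl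
  obtain ⟨F, p, hF⟩ := hf
  obtain ⟨G, q, hG⟩ := hg
  -- Once the `cons` of a nonempty list is popped, head, tail and argument lie side by side; two new
  -- `cons` symbols in front of them form the code of `((b, bs), a)`.
  refine intro (dup.seq (Fl.seq (caseCons (pushCons.seq (pushCons.seq G)) F)))
    (p + q.comp (r + Polynomial.X + 1))
    (4 * Polynomial.X + r + p + q.comp (r + Polynomial.X + 1) + 20) (fun a => ?_) fun a => ?_
  · have h1 := (hF a).1
    have h2 := (hFl a).1
    simp only [Polynomial.eval_add, Polynomial.eval_comp, Polynomial.eval_X, Polynomial.eval_one]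
    cases hla : l a with
    | nil => exact h1.trans (Nat.le_add_right _ _)
    | cons b bs =>
      refine ((hG ((b, bs), a)).1.trans (poly_mono q ?_)).trans (Nat.le_add_left _ _)
      rw [hla] at h2
      simp at h2 ⊢; omega
  · have h2 := (hFl a).1
    have h : (caseCons (pushCons.seq (pushCons.seq G)) F).Computes O.tm.initialState
        (p.eval (sz τ a) + q.eval (r.eval (sz τ a) + sz τ a + 1) + 3) (code τ (l a) ++ code τ a)
        (code τ (match l a with
          | [] => f a
          | b :: bs => g ((b, bs), a))) := by
      cases hla : l a with
      | nil => exact (computes_caseCons_nil (hF a).2).mono (by omega)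
      | cons b bs =>
        have h3 : q.eval (sz τ ((b, bs), a)) ≤ q.eval (r.eval (sz τ a) + sz τ a + 1) := by
          refine poly_mono q ?_
          rw [hla] at h2
          simp at h2 ⊢; omega
        have h4 := (hG ((b, bs), a)).2
        simp only [code_prod, List.cons_append, List.append_assoc] at h4
        rw [code_cons, List.cons_append, List.append_assoc]
        exact (computes_caseCons_cons ((computes_pushCons _).seq
          ((computes_pushCons _).seq h4))).mono (by omega)
    refine ((dup_code a).seq (((hFl a).2.frame _).seq h)).mono ?_
    simp; omega

theorem cmp (f : τ → τ → Bool) : PT O fun x : τ × τ => f x.1 x.2 := by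
  refine intro (pop.seq (cmpTok f)) 3 2 (fun a => by simpa using sz_bool τ _) fun a => ?_
  have h : code τ (f a.1 a.2) = cond (f a.1 a.2) [.cons, .nil, .nil] [.nil] := by
    cases f a.1 a.2 <;> rfl
  rw [h]
  exact ((computes_pop _ _).seq (computes_cmpTok f a.1 a.2)).mono (by simp)

/-- Here `e a` is the string handed to the subroutine. The representation of `a` must be the list of
letters of exactly this string, so that no conversion of the argument is needed. -/
theorem oracle [Inhabited τ] {f : A → Bool} (p : Polynomial ℕ) (e : A → List τ)
    (he : ∀ a, code τ a = codeList (e a))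
    (h : ∀ a, TM2OutputsInTime O.tm ((e a).map O.inputAlphabet.symm)
      (some [O.outputAlphabet.symm (f a)]) (p.eval (e a).length)) : PT O f := by
  refine intro (call O) 3 (2 * Polynomial.X + p + 3) (fun a => by simpa using sz_bool τ _)
    fun a => ?_
  have h1 : (e a).length ≤ sz τ a := by
    rw [sz, he, ← code_list, length_code, sz_toks]; omega
  have h2 := poly_mono p h1
  have h3 : code τ (f a) = cond (f a) [.cons, .nil, .nil] [.nil] := by cases f a <;> rfl
  rw [he, h3]
  refine (computes_call O (h a)).mono ?_
  simp; omega

/-- The number `N` bounds all intermediate states, which are the folds over prefixes of the list. A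
bound on the final state alone would not control the cost of the earlier steps. -/
theorem computes_foldl {f : E × S → S} {F : Frag (OΓ O) (Oσ O)} {p : Polynomial ℕ}
    (hF : ∀ a, F.Computes O.tm.initialState (p.eval (sz τ a)) (code τ a) (code τ (f a)))
    (n N : ℕ) (l : List E) (x : S) (hn : sz τ l ≤ n)
    (hN : ∀ l', l' <+: l → sz τ (List.foldl (fun x e => f (e, x)) x l') ≤ N) :
    (whileCons (rotate.seq (pushCons.seq (F.seq swap)))).Computes O.tm.initialState
      (l.length * (4 * n + 4 * N + 20 + p.eval (n + N + 1)) + 1) (code τ l ++ code τ x)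
      (code τ (List.foldl (fun x e => f (e, x)) x l)) := by
  induction l generalizing x with
  | nil => exact (computes_whileCons_nil _).mono (by simp)
  | cons e l ih =>
    have h1 := ih (f (e, x)) (by simp at hn; omega) fun l' hl' =>
      by simpa using hN (e :: l') (by simpa using hl')
    have hx : sz τ x ≤ N := by simpa using hN [] (by simp)
    have hfx : sz τ (f (e, x)) ≤ N := by simpa using hN [e] (by simp)
    have hp : p.eval (sz τ (e, x)) ≤ p.eval (n + N + 1) :=
      poly_mono p (by simp at hn ⊢; omega)
    -- One round: `e, l, x` is rotated to `e, x, l`, a `cons` makes the first two a pair, `F` turns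
    -- it into the new state, and the swap puts the remaining list back on top.
    have h2 := (rotate_code (O := O) e l x).seq ((computes_pushCons _).seq
        ((by simpa using (hF (e, x)).frame (code τ l) :
          F.Computes O.tm.initialState (p.eval (sz τ (e, x)))
            (.cons :: (code τ e ++ (code τ x ++ code τ l))) _).seq
        (swap_code (f (e, x)) l)))
    have h3 := computes_whileCons_cons h2 h1
    rw [code_cons]
    refine Computes.mono (by simpa using h3) ?_
    simp only [List.length_cons, Nat.succ_mul]
    simp at hn hx hfx hp ⊢
    omega

/-- The growth condition has to be assumed: iterating a polynomial-time step, for example one that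
doubles the state, may lead to exponential size. -/
theorem foldl {f : E × S → S} (hf : PT O f) (q : Polynomial ℕ)
    (hq : ∀ (l : List E) (x : S),
      sz τ (List.foldl (fun x e => f (e, x)) x l) ≤ q.eval (sz τ l + sz τ x)) :
    PT O fun y : List E × S => y.1.foldl (fun x e => f (e, x)) y.2 := by
  obtain ⟨F, p, hF⟩ := hf
  refine intro (pop.seq (whileCons (rotate.seq (pushCons.seq (F.seq swap))))) q
    (Polynomial.X * (4 * Polynomial.X + 4 * q + 20 + p.comp (Polynomial.X + q + 1)) + 2)
    (fun a => ?_) fun a => ?_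
  · exact (hq _ _).trans (poly_mono q (by simp))
  · have h := computes_foldl (fun a => (hF a).2) (sz τ a) (q.eval (sz τ a)) a.1 a.2
      (by simp; omega) fun l' hl' => (hq l' a.2).trans (poly_mono q (by
        obtain ⟨l'', hl''⟩ := hl'
        have := sz_append τ l' l''
        rw [hl''] at this
        have : 0 < sz τ l'' := (Nat.zero_le _).trans_lt (length_lt_sz τ l'')
        simp; omega))
    refine ((computes_pop _ _).seq h).mono ?_
    have h1 : a.1.length ≤ sz τ a := by
      have := length_lt_sz τ a.1
      simp; omega
    have h2 := Nat.mul_le_mul_right (4 * sz τ a + 4 * q.eval (sz τ a) + 20 +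
      p.eval (sz τ a + q.eval (sz τ a) + 1)) h1
    simp only [Polynomial.eval_add, Polynomial.eval_mul, Polynomial.eval_comp, Polynomial.eval_X,
      Polynomial.eval_one, Polynomial.eval_ofNat]
    omega

/-- Iteration over a list with an additional parameter, where every step enlarges the state by at
most a polynomial in the size of the parameter and the element of the list. -/
theorem foldl_param {f : E × G × S → S} (hf : PT O f) (q : Polynomial ℕ)
    (hq : ∀ e g s, sz τ (f (e, g, s)) ≤ sz τ s + q.eval (sz τ e + sz τ g)) :
    PT O fun y : List E × G × S => y.1.foldl (fun s e => f (e, y.2.1, s)) y.2.2 := by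
  -- The parameter is carried along unchanged as a component of the state.
  have key : ∀ (l : List E) (g : G) (s : S),
      l.foldl (fun (x : G × S) e => (x.1, f (e, x))) (g, s) =
        (g, l.foldl (fun s e => f (e, g, s)) s) := by
    intro l g s
    induction l generalizing s with
    | nil => rfl
    | cons e l ih => simp [ih]
  have h := foldl (O := O) (f := fun y : E × G × S => (y.2.1, f y)) ((fst.comp snd).pair hf)
    (Polynomial.X + Polynomial.X * q) (fun l x => ?_)
  · refine (snd.comp h).of_enc (fun y => y) (fun _ => rfl) fun y => ?_
    exact congrArg (fun z : G × S => (Enc.enc z.2 : Val τ)) (key y.1 y.2.1 y.2.2).symm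
  · obtain ⟨g, s⟩ := x
    change sz τ (l.foldl (fun (x : G × S) e => (x.1, f (e, x))) (g, s)) ≤ _
    rw [key]
    -- With `n` fixed in advance, every step adds at most `q.eval n`, although the remaining list
    -- shrinks during the induction.
    have h1 : ∀ n, sz τ l + sz τ g ≤ n →
        sz τ (l.foldl (fun s e => f (e, g, s)) s) ≤ sz τ s + l.length * q.eval n := by
      intro n hn
      induction l generalizing s with
      | nil => simp
      | cons e l ih =>
        have h2 := hq e g s
        have h3 : q.eval (sz τ e + sz τ g) ≤ q.eval n := poly_mono q (by simp at hn; omega)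
        have h4 := ih (f (e, g, s)) (by simp at hn; omega)
        simp only [List.foldl_cons, List.length_cons, Nat.succ_mul]
        omega
    have h2 := h1 (sz τ l + sz τ (g, s)) (by simp; omega)
    have h3 : l.length * q.eval (sz τ l + sz τ (g, s)) ≤
        (sz τ l + sz τ (g, s)) * q.eval (sz τ l + sz τ (g, s)) :=
      Nat.mul_le_mul_right _ (by have := length_lt_sz τ l; omega)
    have h4 := sz_prod τ (g, s)
    simp only [Polynomial.eval_add, Polynomial.eval_mul, Polynomial.eval_X]
    rw [sz_prod]
    dsimp only at h4 ⊢
    omega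

end PT

/-! ### From polynomial-time functions to machines; elementary operations on lists -/

namespace PT

open Frag

/-- A predicate with a decision procedure in `PT` is decidable in polynomial time. -/
theorem inPTime {τ A : Type} {O : TM2ComputableAux τ Bool} [Enc τ A] {f : A → Bool} (h : PT O f)
    (e : A → List τ) (he : ∀ a, code τ a = codeList (e a)) {P : A → Prop}
    (hP : ∀ a, f a = true ↔ P a) : InPTime e P := by
  obtain ⟨F, p, hF⟩ := h
  let F' : Frag (OΓ O) (Oσ O) := loadInput.seq (F.seq storeOutput)
  -- The machine needs a finite input alphabet and finitely many internal states, and the buffers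
  -- hold symbols over `τ`. Finiteness of `τ` is inherited from the input alphabet of the
  -- subroutine.
  let _ : Fintype τ := let _ := O.tm.Γk₀Fin; Fintype.ofEquiv _ O.inputAlphabet
  let _ := O.tm.kFin
  let _ := O.tm.σFin
  let T : FinTM2 :=
    { K := Stk O.tm.K
      k₀ := .inp
      k₁ := .out
      Γ := OΓ O
      Λ := F'.Λ
      main := F'.main
      ΛFin := F'.fin
      σ := Oσ O
      initialState := ((none, none), O.tm.initialState)
      Γk₀Fin := (inferInstance : Fintype τ)
      m := F'.m }
  let T' : TM2ComputableAux τ Bool := ⟨T, Equiv.refl _, Equiv.refl _⟩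
  have key : ∀ a, F'.Runs (2 * (e a).length + 4 + p.eval (2 * (e a).length + 1))
      (((none, none), O.tm.initialState), store { inp := e a } fun _ => [])
      (((none, none), O.tm.initialState), store { out := [f a] } fun _ => []) := by
    intro a
    have h1 := runs_loadInput (Γ := O.tm.Γ) (e a) O.tm.initialState
    have h2 := (hF a).2 []
    have h3 := runs_storeOutput (τ := τ) (Γ := O.tm.Γ) (f a) O.tm.initialState
    have h4 : code τ (f a) = cond (f a) [.cons, .nil, .nil] [.nil] := by cases f a <;> rfl
    -- Each letter contributes a `cons` and a leaf, and the list ends with `nil`; so bounds in the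
    -- size of the representation become bounds in the length of the input string.
    have h5 : sz τ a = 2 * (e a).length + 1 := by
      rw [← sz_toks, sz, sz, he, code_list]
    simp only [List.append_nil, he, h4, h5] at h2
    exact (h1.seq (h2.seq h3)).mono (by omega)
  classical
  refine ⟨⟨T', 2 * Polynomial.X + 4 + p.comp (2 * Polynomial.X + 1), fun a => ?_⟩⟩
  have h1 := key a
  refine ⟨⟨h1.choose, ?_⟩, ?_⟩
  · have h2 := steps_iff_iterate.1 h1.choose_spec.2
    have h3 : decide (P a) = f a := by
      by_cases hp : P a
      · simp [hp, (hP a).2 hp]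
      · simp [hp, mt (hP a).1 hp]
    have h4 : initList T ((e a).map (Equiv.refl τ)) = ⟨some F'.main,
        ((none, none), O.tm.initialState), store { inp := e a } fun _ => []⟩ := by
      rw [initList_eq T' ((e a).map (Equiv.refl τ))]
      have : Function.update (store ({} : Mem τ) fun k => ([] : List (O.tm.Γ k))) .inp (e a) =
        store { inp := e a } fun _ => [] := store_update_inp _ _ _
      rw [← this]
      simp only [Equiv.coe_refl, List.map_id]
      congr 2
      funext k
      rcases k with (_ | _ | _ | _ | _) | _ | _ | _ <;> rfl
    have h5 : haltList T ([f a].map (Equiv.refl Bool)) = ⟨none,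
        ((none, none), O.tm.initialState), store { out := [f a] } fun _ => []⟩ := by
      rw [haltList_eq T' ([f a].map (Equiv.refl Bool))]
      have : Function.update (store ({} : Mem τ) fun k => ([] : List (O.tm.Γ k))) .out [f a] =
        store { out := [f a] } fun _ => [] := store_update_out _ _ _
      rw [← this]
      simp only [Equiv.coe_refl, List.map_id]
      congr 2
      funext k
      rcases k with (_ | _ | _ | _ | _) | _ | _ | _ <;> rfl
    change (flip bind (TM2.step F'.m))^[_] (some (initList T ((e a).map (Equiv.refl τ)))) =
      some (haltList T ((Computability.encodeBool (decide (P a))).map (Equiv.refl Bool)))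
    rw [h4, h3]
    exact h2.trans (congrArg some h5.symm)
  · simpa using h1.choose_spec.1

variable {τ A B C D E S G : Type} [Enc τ A] [Enc τ B] [Enc τ C] [Enc τ D] [Enc τ E] [Enc τ S]
  [Enc τ G] {O : TM2ComputableAux τ Bool}

theorem congr {f g : A → B} (h : PT O f) (hfg : ∀ a, f a = g a) : PT O g :=
  (funext hfg : f = g) ▸ h

theorem cons {f : A → B} {g : A → List B} (hf : PT O f) (hg : PT O g) :
    PT O fun a => f a :: g a :=
  (cast (f := fun x : B × List B => x.1 :: x.2) fun _ => rfl).comp (hf.pair hg)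

theorem toSome {f : A → B} (hf : PT O f) : PT O fun a => some (f a) := by
  have h : PT O fun a => f a :: ([] : List B) := hf.cons (const [])
  exact h.of_enc (fun a => a) (fun _ => rfl) fun _ => rfl

theorem toList : PT O fun o : Option A => o.toList := cast fun o => by cases o <;> rfl

theorem isNil : PT O fun l : List A => l.isEmpty :=
  (listCase (f := fun _ : List A => true) (g := fun _ : (A × List A) × List A => false)
    id (const true) (const false)).congr fun l => by cases l <;> rfl

theorem tail : PT O fun l : List A => l.tail :=
  (listCase (f := fun _ : List A => ([] : List A)) (g := fun x : (A × List A) × List A => x.1.2)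
    id (const []) (snd.comp fst)).congr fun l => by cases l <;> rfl

theorem and {f g : A → Bool} (hf : PT O f) (hg : PT O g) : PT O fun a => f a && g a :=
  (hf.ite hg (const false)).congr fun a => by cases f a <;> rfl

theorem test (f : τ → Bool) : PT O f := (cmp fun a _ => f a).comp (id.pair id)

/-- Iteration over a list where every step enlarges the state by at most a polynomial in the size
of the element of the list. -/
theorem foldl_add {f : E × S → S} (hf : PT O f) (q : Polynomial ℕ)
    (hq : ∀ e s, sz τ (f (e, s)) ≤ sz τ s + q.eval (sz τ e)) :
    PT O fun y : List E × S => y.1.foldl (fun s e => f (e, s)) y.2 := by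
  -- The parameter is a dummy.
  have h := foldl_param (G := Bool) (f := fun y => f (y.1, y.2.2))
    (hf.comp (fst.pair (snd.comp snd))) q fun e g s =>
      (hq e s).trans (Nat.add_le_add_left (poly_mono q (Nat.le_add_right _ _)) _)
  exact h.comp (fst.pair ((const true).pair snd))

theorem reverseAux : PT O fun x : List A × List A => x.1.reverse ++ x.2 := by
  refine (foldl_add (f := fun y : A × List A => y.1 :: y.2) (cast fun _ => rfl)
    (Polynomial.X + 1) fun e s => by simp; omega).congr fun x => ?_
  obtain ⟨l, l'⟩ := x
  induction l generalizing l' with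
  | nil => rfl
  | cons a l ih => simp [ih (a :: l')]

theorem reverse : PT O fun l : List A => l.reverse :=
  (reverseAux.comp (id.pair (const []))).congr fun l => by simp

theorem append {f g : A → List B} (hf : PT O f) (hg : PT O g) : PT O fun a => f a ++ g a :=
  (reverseAux.comp ((reverse.comp hf).pair hg)).congr fun a => by simp

/-- One step of the comparison of two lists of letters. -/
def _root_.UTA.eqStep [DecidableEq τ] (y : τ × List τ × Bool) : List τ × Bool :=
  match y.2.1 with
  | [] => ([], false)
  | b :: bs => (bs, y.2.2 && decide (y.1 = b))

/-- The flag becomes false at a mismatch or when `l'` is too short; if `l'` is too long, a nonempty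
rest remains. -/
theorem _root_.UTA.eqStep_foldl [DecidableEq τ] (l l' : List τ) (c : Bool) :
    (l.foldl (fun s e => eqStep (e, s)) (l', c)).2 &&
      (l.foldl (fun s e => eqStep (e, s)) (l', c)).1.isEmpty ↔ c = true ∧ l = l' := by
  induction l generalizing l' c with
  | nil => cases l' <;> simp
  | cons a l ih =>
    rw [List.foldl_cons, ih]
    cases l' <;> simp [eqStep, and_assoc]

theorem eq [DecidableEq τ] : PT O fun x : List τ × List τ => decide (x.1 = x.2) := by
  have h1 : PT O (eqStep (τ := τ)) :=
    (listCase (l := fun y : τ × List τ × Bool => y.2.1)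
      (f := fun _ => (([], false) : List τ × Bool))
      (g := fun z : (τ × List τ) × (τ × List τ × Bool) =>
        (z.1.2, z.2.2.2 && decide (z.2.1 = z.1.1)))
      (fst.comp snd) (const _) ((snd.comp fst).pair (((snd.comp snd).comp snd).and
        ((cmp fun a b => decide (a = b)).comp
          ((fst.comp snd).pair (fst.comp fst)))))).congr fun y => by
      obtain ⟨a, l, c⟩ := y
      cases l <;> rfl
  have h2 := foldl_add h1 3 fun e s => by
    obtain ⟨l, c⟩ := s
    cases l with
    | nil => simp [eqStep]
    | cons b l =>
      have := sz_bool τ (c && decide (e = b))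
      simp [eqStep] at this ⊢; omega
  have h3 := h2.comp (fst.pair (snd.pair (const true)) : PT O fun x : List τ × List τ =>
    (x.1, x.2, true))
  refine ((snd.comp h3).and (isNil.comp (fst.comp h3))).congr fun x => ?_
  rw [Bool.eq_iff_iff, eqStep_foldl]
  simp

end PT

end UTA

namespace UTA

open Turing PT

/-! ## Parsing -/

section Parsing

variable {α : Type}

/-- Strings over the input alphabet. -/
abbrev Str (α : Type) : Type := List (Tok α)

namespace Tok

/-- Whether the letter ends a word, a name or a list. -/
def isClose : Tok α → Bool
  | .close => true
  | _ => false

/-- Whether the letter starts an element of a list. -/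
def isItem : Tok α → Bool
  | .item => true
  | _ => false

/-- Whether the letter is a letter of a data value. -/
def isLetter : Tok α → Bool
  | .letter _ => true
  | _ => false

/-- Whether the letter is followed by two terms. -/
def isBinary : Tok α → Bool
  | .comp => true
  | .plus => true
  | .conj => true
  | _ => false

end Tok

/-- One step of the extraction of the first term: the state consists of a unary counter for the
terms to be read, and the letters before and after the end of the first term in reverse. -/
def splitStep (y : Tok α × Str α × Str α × Str α) : Str α × Str α × Str α :=
  match y.2.1 with
  | [] => ([], y.2.2.1, y.1 :: y.2.2.2)
  | u :: c => (if y.1.isClose then c else if y.1.isBinary then u :: u :: c else u :: c,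
      y.1 :: y.2.2.1, y.2.2.2)

/-- Split a string after its first term. -/
def split (s : Str α) : Str α × Str α :=
  let r := s.foldl (fun x e => splitStep (e, x)) ([Tok.close], [], [])
  (r.2.1.reverse, r.2.2.reverse)

/-- Strings that are terms in prefix notation. -/
def IsTerm (s : Str α) : Prop :=
  ∀ u c l r, s.foldl (fun x e => splitStep (e, x)) (u :: c, l, r) = (c, s.reverse ++ l, r)

theorem splitStep_nil (e : Tok α) (l r : Str α) :
    splitStep (e, [], l, r) = ([], l, e :: r) := rfl

theorem splitStep_cons (e u : Tok α) (c l r : Str α) :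
    splitStep (e, u :: c, l, r) =
      (if e.isClose then c else if e.isBinary then u :: u :: c else u :: c, e :: l, r) := rfl

theorem splitStep_foldl_nil (s l r : Str α) :
    s.foldl (fun x e => splitStep (e, x)) ([], l, r) = ([], l, s.reverse ++ r) := by
  induction s generalizing r with
  | nil => rfl
  | cons a s ih => simp [splitStep_nil, ih]

/-- Reading a term lowers the counter by exactly one. Started at one, it is empty right after the
first term, and all later letters go to the second component. -/
theorem IsTerm.split {s : Str α} (h : IsTerm s) (r : Str α) : split (s ++ r) = (s, r) := by
  simp [UTA.split, h _ _ _ _, splitStep_foldl_nil]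

theorem isTerm_close : IsTerm [(Tok.close : Tok α)] := fun _ _ _ _ => rfl

theorem IsTerm.unary {s : Str α} (h : IsTerm s) {e : Tok α} (h₁ : e.isClose = false)
    (h₂ : e.isBinary = false) : IsTerm (e :: s) := fun u c l r => by
  simp [splitStep_cons, h₁, h₂, h _ _ _ _]

theorem IsTerm.binary {s s' : Str α} (h : IsTerm s) (h' : IsTerm s') {e : Tok α}
    (h₁ : e.isClose = false) (h₂ : e.isBinary = true) : IsTerm (e :: (s ++ s')) :=
  fun u c l r => by simp [splitStep_cons, h₁, h₂, h _ _ _ _, h' _ _ _ _]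

theorem isTerm_encodeWord (d : List α) : IsTerm (encodeWord d) := by
  induction d with
  | nil => exact isTerm_close
  | cons a d ih => exact ih.unary (e := .letter a) rfl rfl

theorem isTerm_encodeName (q : List Bool) : IsTerm (encodeName q : Str α) := by
  induction q with
  | nil => exact isTerm_close
  | cons a d ih => exact ih.unary (e := .bit a) rfl rfl

theorem Pattern.isTerm_encode (π : Pattern α) : IsTerm π.encode := by
  induction π with
  | word d => exact (isTerm_encodeWord d).unary rfl rfl
  | comp _ _ h h' | plus _ _ h h' => exact h.binary h' rfl rfl
  | star _ h => exact h.unary rfl rfl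

theorem EdgeFilter.isTerm_encode {Pat : Set (Pattern α)} (φ : EdgeFilter Pat) :
    IsTerm φ.encode := by
  induction φ with
  | pat π => exact (Pattern.isTerm_encode π.1).unary rfl rfl
  | prop q => exact (isTerm_encodeName q).unary rfl rfl
  | conj _ _ h h' => exact h.binary h' rfl rfl
  | neg _ h => exact h.unary rfl rfl

variable {O : TM2ComputableAux (Tok α) Bool}

theorem PT.splitStep : PT O (splitStep (α := α)) := by
  let T : Type := Tok α × Str α × Str α × Str α
  have e : PT O fun z : (Tok α × Str α) × T => z.2.1 := fst.comp snd
  have c : PT O fun z : (Tok α × Str α) × T => z.1.2 := snd.comp fst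
  have uc : PT O fun z : (Tok α × Str α) × T => z.1.1 :: z.1.2 := (fst.comp fst).cons c
  refine (listCase (l := fun y : T => y.2.1)
    (f := fun y => (([], y.2.2.1, y.1 :: y.2.2.2) : Str α × Str α × Str α))
    (g := fun z => (if z.2.1.isClose then z.1.2 else if z.2.1.isBinary then
      z.1.1 :: z.1.1 :: z.1.2 else z.1.1 :: z.1.2, z.2.1 :: z.2.2.2.1, z.2.2.2.2))
    (fst.comp snd) ((const _).pair ((fst.comp (snd.comp snd)).pair
      (fst.cons (snd.comp (snd.comp snd)))))
    ((((test Tok.isClose).comp e).ite c (((test Tok.isBinary).comp e).ite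
      ((fst.comp fst).cons uc) uc)).pair ((e.cons (fst.comp (snd.comp (snd.comp snd)))).pair
      (snd.comp (snd.comp (snd.comp snd)))))).congr fun y => ?_
  obtain ⟨a, l, x⟩ := y
  cases l <;> rfl

theorem sz_splitStep (e : Tok α) (s : Str α × Str α × Str α) :
    sz (Tok α) (UTA.splitStep (e, s)) ≤ sz (Tok α) s + 4 := by
  obtain ⟨c, l, r⟩ := s
  cases c with
  | nil => simp [UTA.splitStep]; omega
  | cons u c => simp only [UTA.splitStep]; split_ifs <;> simp <;> omega

theorem PT.split : PT O (split (α := α)) := by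
  have h := (foldl_add PT.splitStep 4 fun e s =>
    (sz_splitStep e s).trans (by simp)).comp
    (id.pair (const ([Tok.close], [], [])) : PT O fun s : Str α =>
      (s, (([Tok.close], [], []) : Str α × Str α × Str α)))
  exact (reverse.comp (fst.comp (snd.comp h))).pair (reverse.comp (snd.comp (snd.comp h)))

theorem length_split (s : Str α) :
    (UTA.split s).1.length + (UTA.split s).2.length = s.length := by
  have h : ∀ (s : Str α) (x : Str α × Str α × Str α),
      (s.foldl (fun x e => UTA.splitStep (e, x)) x).2.1.length +
        (s.foldl (fun x e => UTA.splitStep (e, x)) x).2.2.length =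
      x.2.1.length + x.2.2.length + s.length := by
    intro s
    induction s with
    | nil => intro x; rfl
    | cons a s ih =>
      rintro ⟨c, l, r⟩
      rw [List.foldl_cons, ih]
      cases c <;> simp [UTA.splitStep] <;> omega
  simpa [UTA.split] using h s ([Tok.close], [], [])

/-- Reading hardly enlarges the data: the object read and the rest together exceed the input by a
constant only. This makes repeated reading from the same string an iteration with bounded growth. -/
theorem sz_split (s : Str α) : sz (Tok α) (UTA.split s) = sz (Tok α) s + 2 := by
  have := length_split s
  simp [sz_toks]; omega

/-! ### Reading pairs and lists of objects -/

variable {B C : Type}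

/-- Read two consecutive objects. -/
def readBoth (t : Str α → B × Str α) (t' : Str α → C × Str α) (s : Str α) : (B × C) × Str α :=
  (((t s).1, (t' (t s).2).1), (t' (t s).2).2)

theorem PT.readBoth [Enc (Tok α) B] [Enc (Tok α) C] {t : Str α → B × Str α}
    {t' : Str α → C × Str α} (h : PT O t)
    (h' : PT O t') : PT O (readBoth t t') :=
  ((fst.comp h).pair (fst.comp (h'.comp (snd.comp h)))).pair (snd.comp (h'.comp (snd.comp h)))

theorem sz_readBoth [Enc (Tok α) B] [Enc (Tok α) C] {t : Str α → B × Str α}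
    {t' : Str α → C × Str α} {i j : ℕ}
    (h : ∀ s, sz (Tok α) (t s) ≤ sz (Tok α) s + i)
    (h' : ∀ s, sz (Tok α) (t' s) ≤ sz (Tok α) s + j) (s : Str α) :
    sz (Tok α) (UTA.readBoth t t' s) ≤ sz (Tok α) s + (i + j) := by
  have h1 := h s
  have h2 := h' (t s).2
  simp [UTA.readBoth] at h1 h2 ⊢
  omega

/-- One step of reading a list. -/
def listStep (t : Str α → B × Str α) (y : Tok α × List B × Str α) : List B × Str α :=
  match y.2.2 with
  | [] => y.2
  | e :: s => if e.isItem then ((t s).1 :: y.2.1, (t s).2) else y.2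

theorem listStep_close (t : Str α → B × Str α) (a : Tok α) (b : List B) (s : Str α) :
    listStep t (a, b, .close :: s) = (b, .close :: s) := rfl

theorem listStep_item (t : Str α → B × Str α) (a : Tok α) (b : List B) (s : Str α) :
    listStep t (a, b, .item :: s) = ((t s).1 :: b, (t s).2) := rfl

/-- Read a list, which is returned in reverse. -/
def readList (t : Str α → B × Str α) (s : Str α) : List B × Str α :=
  let r := s.foldl (fun x e => listStep t (e, x)) ([], s)
  (r.1, r.2.tail)

theorem PT.readList [Enc (Tok α) B] {t : Str α → B × Str α} (h : PT O t) (i : ℕ)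
    (hi : ∀ s, sz (Tok α) (t s) ≤ sz (Tok α) s + i) : PT O (readList t) := by
  have h1 : PT O (listStep t) := by
    let T : Type := Tok α × List B × Str α
    have ht : PT O fun z : (Tok α × Str α) × T => t z.1.2 := h.comp (snd.comp fst)
    refine (listCase (l := fun y : T => y.2.2) (f := fun y => y.2)
      (g := fun z => if z.1.1.isItem then ((t z.1.2).1 :: z.2.2.1, (t z.1.2).2) else z.2.2)
      (snd.comp snd) snd (((test Tok.isItem).comp (fst.comp fst)).ite
        (((fst.comp ht).cons (fst.comp (snd.comp snd))).pair (snd.comp ht))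
        (snd.comp snd))).congr fun y => ?_
    obtain ⟨e, l, s⟩ := y
    cases s <;> rfl
  have h2 := (foldl_add h1 (Polynomial.C i) fun e s => by
    obtain ⟨l, s⟩ := s
    cases s with
    | nil => simp [listStep]
    | cons a s =>
      have := hi s
      simp only [listStep]
      split_ifs
      · simp at this ⊢; omega
      · simp).comp (id.pair ((const []).pair id) : PT O fun s : Str α =>
        (s, (([], s) : List B × Str α)))
  exact (fst.comp h2).pair (tail.comp (snd.comp h2))

/-- The fold ignores the letters it runs over; the string only provides enough rounds. Once the
closing letter is reached, further rounds change nothing. -/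
theorem readList_append {t : Str α → B × Str α} {D : Type} {e : D → Str α} {g : D → B}
    (h : ∀ x s, t (e x ++ s) = (g x, s)) (l : List D) (s : Str α) :
    UTA.readList t (encodeList e l ++ s) = ((l.map g).reverse, s) := by
  have stable : ∀ (f : Str α) (b : List B),
      f.foldl (fun x e => listStep t (e, x)) (b, .close :: s) = (b, .close :: s) := by
    intro f b
    induction f with
    | nil => rfl
    | cons a f ih => simpa [listStep_close] using ih
  have key : ∀ (f : Str α) (l : List D) (b : List B), l.length ≤ f.length →
      f.foldl (fun x e => listStep t (e, x)) (b, encodeList e l ++ s) =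
        ((l.map g).reverse ++ b, .close :: s) := by
    intro f l
    induction l generalizing f with
    | nil => intro b _; exact stable f b
    | cons x l ih =>
      intro b hl
      cases f with
      | nil => simp at hl
      | cons a f =>
        have := ih f (g x :: b) (by simpa using hl)
        simpa [listStep_item, encodeList, h] using this
  -- Every element of the list is announced by a letter `item`, so there are at least as many rounds
  -- as elements.
  have hl : l.length ≤ (encodeList e l ++ s).length := by
    have : l.length ≤ (encodeList e l).length := by
      clear key stable
      induction l with
      | nil => simp
      | cons x l ih => simp [encodeList]; omega
    simp; omega
  simp [UTA.readList, key _ l [] hl]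

end Parsing

end UTA

namespace UTA

open Turing PT

/-! ## The membership algorithm -/

/-- Names of states, represented by their string encoding. -/
def Name : Type := List Bool

instance : DecidableEq Name := inferInstanceAs (DecidableEq (List Bool))

/-- Data values, represented by their string encoding. -/
def Word (α : Type) : Type := List α

/-- Data values together with at most one state, represented by their string encoding. -/
def QItem (α : Type) : Type := List α × Option Name

/-- Instances of singleton-membership, represented by their string encoding. -/
def Query {α : Type} (Pat : Set (Pattern α)) : Type := SingletonInstance Pat

section Algorithm

variable {α : Type} {Pat : Set (Pattern α)}

/-- The part of the encoding of a query that describes the item. -/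
def QItem.encode (x : QItem α) : Str α :=
  encodeWord x.1 ++ encodeList encodeName (Option.toList x.2)

/-- The item of `x`. -/
def QItem.toItem (x : QItem α) : Item α := (x.1, {q | x.2 = some q})

/-- Names, words, items, filters and queries are represented by their literal encodings, not by the
generic instances for lists and pairs. Hence substrings of the input can be used without conversion,
and a query for the subroutine arises by concatenation. -/
instance : Enc (Tok α) Name := ⟨fun q => Enc.enc (encodeName q : Str α)⟩

instance : Enc (Tok α) (Word α) := ⟨fun d => Enc.enc (encodeWord d : Str α)⟩

instance : Enc (Tok α) (QItem α) := ⟨fun x => Enc.enc x.encode⟩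

instance : Enc (Tok α) (EdgeFilter Pat) := ⟨fun φ => Enc.enc φ.encode⟩

instance : Enc (Tok α) (Query Pat) := ⟨fun x => Enc.enc (SingletonInstance.encode x)⟩

open Classical in
/-- The Boolean form of singleton-membership. -/
noncomputable def Query.holds (x : Query Pat) : Bool := decide (SingletonInstance.Holds x)

/-- The rules of a horizontal automaton. -/
abbrev Rule (Pat : Set (Pattern α)) : Type := (Name × EdgeFilter Pat) × Name

/-- The vertical rules. -/
abbrev VRule : Type := Name × Name

/-- The horizontal rules, the initial horizontal state, the final states and the vertical rules of
an automaton. -/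
abbrev Params (Pat : Set (Pattern α)) : Type := (List (Rule Pat) × Name) × List Name × List VRule

/-- A query from its components. -/
def mkQuery (y : EdgeFilter Pat × QItem α) : Query Pat := y

/-- Try to apply a rule to an item; the state consists of the horizontal state and of whether a
rule has been applied. -/
noncomputable def ruleStep (y : Rule Pat × QItem α × Name × Bool) : Name × Bool :=
  if y.2.2.2 then y.2.2
  else if y.1.1.1 = y.2.2.1 then
    if (mkQuery (y.1.1.2, y.2.1)).holds then (y.1.2, true)
    else y.2.2
  else y.2.2

/-- Apply the first applicable rule to an item. -/
noncomputable def findRule (y : List (Rule Pat) × QItem α × Name × Bool) : Name × Bool :=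
  y.1.foldl (fun s e => ruleStep (e, y.2.1, s)) y.2.2

/-- Try to consume an item; the state consists of the horizontal state and the remaining items. -/
noncomputable def passStep (y : QItem α × List (Rule Pat) × Name × List (QItem α)) :
    Name × List (QItem α) :=
  if (findRule (y.2.1, y.1, y.2.2.1, false)).2 then
    ((findRule (y.2.1, y.1, y.2.2.1, false)).1, y.2.2.2)
  else (y.2.2.1, y.1 :: y.2.2.2)

/-- Try to consume every item once. -/
noncomputable def pass (y : List (Rule Pat) × Name × List (QItem α)) : Name × List (QItem α) :=
  y.2.2.foldl (fun s e => passStep (e, y.1, s)) (y.2.1, [])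

/-- Consume items as long as possible. -/
noncomputable def run (y : List (Rule Pat) × Name × List (QItem α)) : Name × List (QItem α) :=
  y.2.2.foldl (fun s _ => pass (y.1, s)) y.2

/-- Replace the value if the left-hand side of the vertical rule is the given state. -/
def targetStep (y : VRule × Name × Option Name) : Option Name :=
  if y.1.1 = y.2.1 then some y.1.2 else y.2.2

/-- The last value assigned to a horizontal state by the vertical rules. -/
def target (y : List VRule × Name) : Option Name :=
  y.1.foldl (fun s e => targetStep (e, y.2, s)) none

/-- The state assigned to a list of items. -/
noncomputable def value (y : Params Pat × List (QItem α)) : Option Name :=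
  if (run (y.1.1.1, y.1.1.2, y.2)).2.isEmpty then
    target (y.1.2.2, (run (y.1.1.1, y.1.1.2, y.2)).1)
  else none

/-- The empty word. -/
def Word.nil : Word α := ([] : List α)

/-- Put a letter in front of a word. -/
def letterCons (y : Tok α × Word α) : Word α :=
  match y.1 with
  | .letter a => List.cons a y.2
  | _ => y.2

/-- An item from its components. -/
def mkItem (y : Word α × Option Name) : QItem α := y

/-- One step of the evaluation of the encoding of a tree from right to left. The state consists of
the word that is being read and a stack of lists of items. The end of a word is treated like
an empty tree, to be removed at the beginning of its edge. -/
noncomputable def treeStep (y : Tok α × Params Pat × Word α × List (List (QItem α))) :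
    Word α × List (List (QItem α)) :=
  if y.1.isClose then (Word.nil, [] :: y.2.2.2)
  else if y.1.isLetter then (letterCons (y.1, y.2.2.1), y.2.2.2)
  else match y.2.2.2 with
    | [] => y.2.2
    | _ :: l => match l with
      | [] => y.2.2
      | M :: l => match l with
        | [] => y.2.2
        | N :: l => (Word.nil, (mkItem (y.2.2.1, value (y.2.1, M)) :: N) :: l)

/-- Evaluate the encoding of a tree. -/
noncomputable def readTree (y : Params Pat × Str α) : Word α × List (List (QItem α)) :=
  y.2.reverse.foldl (fun s e => treeStep (e, y.1, s)) (Word.nil, [])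

/-- Membership in a list of names. -/
def memName (y : List Name × Name) : Bool :=
  y.1.foldl (fun s e => if e = y.2 then true else s) false

/-- Whether the automaton accepts the encoded tree. -/
noncomputable def accepts (y : Params Pat × Str α) : Bool :=
  match (readTree y).2 with
  | [] => false
  | M :: _ => match (value (y.1, M)).toList with
    | [] => false
    | q :: _ => memName (y.1.2.1, q)

/-! ### Time bounds -/

variable {O : TM2ComputableAux (Tok α) Bool}

/-- Encoding of names is injective, so comparing the strings is enough. -/
theorem PT.nameEq : PT O fun x : Name × Name => decide (x.1 = x.2) := by
  classical
  refine (eq (τ := Tok α) (O := O)).of_enc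
    (fun x : Name × Name => ((encodeName x.1 : Str α), (encodeName x.2 : Str α)))
    (fun _ => rfl) fun x => ?_
  congr 1
  rw [decide_eq_decide]
  refine ⟨fun h => congrArg (fun q : Name => (encodeName q : Str α)) h, fun h => ?_⟩
  have inj : Function.Injective (Tok.bit (α := α)) := fun a b h => by cases h; rfl
  exact inj.list_map (List.append_cancel_right h)

theorem PT.mkQuery : PT O (mkQuery (Pat := Pat)) := by
  have h : PT O fun y : Str α × Str α => y.1 ++ y.2 := fst.append snd
  refine h.of_enc
    (fun x : EdgeFilter Pat × QItem α => ((x.1.encode : Str α), x.2.encode))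
    (fun _ => rfl) fun x => ?_
  exact congrArg (Enc.enc (τ := Tok α)) (List.append_assoc x.1.encode (encodeWord x.2.1) _)

theorem PT.mkItem : PT O (mkItem (α := α)) := by
  have h : PT O fun y : Str α × Option Name =>
      match y.2.toList with
      | [] => [Tok.close]
      | q :: _ => Tok.item :: ((encodeName q : Str α) ++ [Tok.close]) := by
    have hq : PT O fun q : Name => (encodeName q : Str α) := PT.cast fun _ => rfl
    exact (listCase (l := fun y : Str α × Option Name => y.2.toList) (f := fun _ => [Tok.close])
      (g := fun z : (Name × List Name) × (Str α × Option Name) =>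
        Tok.item :: ((encodeName z.1.1 : Str α) ++ [Tok.close]))
      (toList.comp snd) (const _) ((const _).cons
        ((hq.comp (fst.comp fst)).append (const _)))).congr fun y => by
          cases y.2.toList <;> rfl
  refine (fst.append h).of_enc (fun y : Word α × Option Name => ((encodeWord y.1 : Str α), y.2))
    (fun _ => rfl) fun y => ?_
  obtain ⟨d, q⟩ := y
  cases q <;> rfl

theorem PT.letterCons : PT O (letterCons (α := α)) := by
  refine (((test Tok.isLetter).comp fst).ite (fst.cons snd) snd : PT O fun y : Tok α × Str α =>
    if y.1.isLetter then y.1 :: y.2 else y.2).of_enc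
      (fun y => (y.1, (encodeWord y.2 : Str α))) (fun _ => rfl) fun y => ?_
  obtain ⟨e, d⟩ := y
  cases e <;> rfl

theorem PT.ruleStep (hO : PT O (Query.holds (Pat := Pat))) : PT O (ruleStep (Pat := Pat)) := by
  let T : Type := Rule Pat × QItem α × Name × Bool
  have s : PT O fun y : T => y.2.2 := snd.comp snd
  refine ((snd.comp s).ite s ((PT.nameEq.comp ((fst.comp (fst.comp fst)).pair (fst.comp s))).ite
    ((hO.comp (PT.mkQuery.comp ((snd.comp (fst.comp fst)).pair (fst.comp snd)))).ite
      ((snd.comp fst).pair (const true)) s) s)).congr fun y => ?_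
  simp only [UTA.ruleStep, decide_eq_true_eq]

theorem ruleStep_cases (y : Rule Pat × QItem α × Name × Bool) :
    UTA.ruleStep y = y.2.2 ∨ UTA.ruleStep y = (y.1.2, true) := by
  unfold UTA.ruleStep
  split_ifs <;> simp

/-- Used for size bounds: the horizontal state is always the old one or one that occurs in the list
of rules. -/
theorem findRule_cases (rs : List (Rule Pat)) (x : QItem α) (s : Name × Bool) :
    UTA.findRule (rs, x, s) = s ∨ ∃ r ∈ rs, UTA.findRule (rs, x, s) = (r.2, true) := by
  induction rs generalizing s with
  | nil => exact .inl rfl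
  | cons r rs ih =>
    change UTA.findRule (rs, x, UTA.ruleStep (r, x, s)) = _ ∨
      ∃ r' ∈ _, UTA.findRule (rs, x, UTA.ruleStep (r, x, s)) = _
    rcases ih (UTA.ruleStep (r, x, s)) with h | ⟨r', hr', h⟩
    · rcases ruleStep_cases (r, x, s) with h' | h'
      · exact .inl (h.trans h')
      · exact .inr ⟨r, by simp, h.trans h'⟩
    · exact .inr ⟨r', by simp [hr'], h⟩

theorem sz_mem {A : Type} [Enc (Tok α) A] {a : A} {l : List A} (h : a ∈ l) :
    sz (Tok α) a < sz (Tok α) l := by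
  induction l with
  | nil => simp at h
  | cons b l ih =>
    rcases List.mem_cons.1 h with rfl | h
    · simp
    · have := ih h
      simp; omega

theorem PT.findRule (hO : PT O (Query.holds (Pat := Pat))) : PT O (findRule (Pat := Pat)) :=
  foldl_param (PT.ruleStep hO) (Polynomial.X + 3) fun e g s => by
    rcases ruleStep_cases (e, g, s) with h | h <;> rw [h]
    · simp
    · simp; omega

theorem PT.passStep (hO : PT O (Query.holds (Pat := Pat))) : PT O (passStep (Pat := Pat)) := by
  let T : Type := QItem α × List (Rule Pat) × Name × List (QItem α)
  have p : PT O fun y : T => y.2.2.1 := fst.comp (snd.comp snd)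
  have l : PT O fun y : T => y.2.2.2 := snd.comp (snd.comp snd)
  have r := (PT.findRule hO).comp ((fst.comp snd).pair (fst.pair (p.pair (const false))))
  exact (snd.comp r).ite ((fst.comp r).pair l) (p.pair (fst.cons l))

/-- The maximum, in place of a sum, reflects that states are copied from the rules and never built
up; thus it does not grow under iteration, as `sz_pass` uses. -/
theorem sz_passStep (x : QItem α) (rs : List (Rule Pat)) (s : Name × List (QItem α)) :
    sz (Tok α) (UTA.passStep (x, rs, s)).1 ≤ max (sz (Tok α) s.1) (sz (Tok α) rs) ∧
      sz (Tok α) (UTA.passStep (x, rs, s)).2 ≤ sz (Tok α) s.2 + sz (Tok α) x + 1 := by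
  simp only [UTA.passStep]
  split_ifs
  · refine ⟨?_, by simp; omega⟩
    rcases findRule_cases rs x (s.1, false) with h | ⟨r, hr, h⟩
    · rw [h]; exact le_max_left _ _
    · rw [h]
      have := sz_mem (α := α) hr
      simp at this ⊢; omega
  · refine ⟨le_max_left _ _, ?_⟩
    simp; omega

theorem PT.pass (hO : PT O (Query.holds (Pat := Pat))) : PT O (pass (Pat := Pat)) := by
  have h := foldl_param (O := O) (PT.passStep hO) (Polynomial.X + 1) fun x rs s => by
    have := sz_passStep x rs s
    simp at this ⊢; omega
  exact (h.comp ((snd.comp snd).pair (fst.pair ((fst.comp snd).pair (const []))))).congr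
    fun _ => rfl

theorem sz_pass (rs : List (Rule Pat)) (p : Name) (l : List (QItem α)) :
    sz (Tok α) (UTA.pass (rs, p, l)).1 ≤ max (sz (Tok α) p) (sz (Tok α) rs) ∧
      sz (Tok α) (UTA.pass (rs, p, l)).2 ≤ sz (Tok α) l := by
  have key : ∀ (l : List (QItem α)) (s : Name × List (QItem α)),
      sz (Tok α) (l.foldl (fun s e => UTA.passStep (e, rs, s)) s).1 ≤
          max (sz (Tok α) s.1) (sz (Tok α) rs) ∧
        sz (Tok α) (l.foldl (fun s e => UTA.passStep (e, rs, s)) s).2 + 1 ≤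
          sz (Tok α) s.2 + sz (Tok α) l := by
    intro l
    induction l with
    | nil => intro s; simp
    | cons x l ih =>
      intro s
      have h1 := ih (UTA.passStep (x, rs, s))
      have h2 := sz_passStep x rs s
      simp at h1 h2 ⊢
      omega
  simpa [UTA.pass, add_comm] using key l (p, [])

theorem PT.run (hO : PT O (Query.holds (Pat := Pat))) : PT O (run (Pat := Pat)) := by
  have h := foldl_param (O := O) (f := fun y : QItem α × List (Rule Pat) × Name × List (QItem α) =>
    UTA.pass y.2) ((PT.pass hO).comp snd) Polynomial.X fun x rs s => by
      have := sz_pass rs s.1 s.2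
      simp at this ⊢; omega
  exact (h.comp ((snd.comp snd).pair id)).congr fun _ => rfl

theorem PT.target : PT O target := by
  have h1 : PT O targetStep :=
    ((PT.nameEq.comp ((fst.comp fst).pair (fst.comp snd))).ite (PT.toSome (snd.comp fst))
      (snd.comp snd)).congr fun y => by simp [targetStep]
  have h2 := foldl_param (O := O) h1 (Polynomial.X + 2) fun e g s => by
    simp only [targetStep]
    split_ifs
    · simp; omega
    · simp
  exact (h2.comp (fst.pair (snd.pair (const none)))).congr fun _ => rfl

theorem target_mem (vs : List VRule) (p : Name) :
    UTA.target (vs, p) = none ∨ ∃ q, (p, q) ∈ vs ∧ UTA.target (vs, p) = some q := by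
  have key : ∀ (vs : List VRule) (s : Option Name),
      vs.foldl (fun s e => targetStep (e, p, s)) s = s ∨
        ∃ q, (p, q) ∈ vs ∧ vs.foldl (fun s e => targetStep (e, p, s)) s = some q := by
    intro vs
    induction vs with
    | nil => intro s; exact .inl rfl
    | cons v vs ih =>
      intro s
      obtain ⟨p', q'⟩ := v
      rcases ih (targetStep ((p', q'), p, s)) with h | ⟨q, hq, h⟩
      · by_cases hp : p' = p
        · subst hp
          exact .inr ⟨q', by simp, by simpa [targetStep] using h⟩
        · exact .inl (by simpa [targetStep, hp] using h)
      · exact .inr ⟨q, by simp [hq], h⟩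
  exact key vs none

theorem PT.value (hO : PT O (Query.holds (Pat := Pat))) : PT O (value (Pat := Pat)) := by
  let T : Type := Params Pat × List (QItem α)
  have g : PT O fun y : T => y.1 := fst
  have r := (PT.run hO).comp ((fst.comp (fst.comp g)).pair ((snd.comp (fst.comp g)).pair snd))
  exact (isNil.comp (snd.comp r)).ite
    (PT.target.comp ((snd.comp (snd.comp g)).pair (fst.comp r))) (const none)

/-- The value is absent or the right-hand side of a vertical rule, so the bound does not involve the
items. Otherwise sizes could accumulate with the depth of the tree. -/
theorem sz_value (g : Params Pat) (l : List (QItem α)) :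
    sz (Tok α) (UTA.value (g, l)) ≤ sz (Tok α) g + 2 := by
  have h : ∀ p, sz (Tok α) (UTA.target (g.2.2, p)) ≤ sz (Tok α) g + 2 := by
    intro p
    rcases target_mem g.2.2 p with h | ⟨q, hq, h⟩
    · simp [h]
    · have := sz_mem (α := α) hq
      rw [h]
      simp at this ⊢; omega
  unfold UTA.value
  split_ifs
  · exact h _
  · simp

theorem sz_mkItem (d : Word α) (q : Option Name) :
    sz (Tok α) (UTA.mkItem (d, q)) ≤ sz (Tok α) d + sz (Tok α) q + 6 := by
  have h : sz (Tok α) d = sz (Tok α) (encodeWord d : Str α) := rfl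
  cases q with
  | none =>
    have h1 : sz (Tok α) (UTA.mkItem (d, none)) =
      sz (Tok α) ((encodeWord d : Str α) ++ [Tok.close]) := rfl
    rw [h, h1, sz_toks, sz_toks]
    simp; omega
  | some q =>
    have h1 : sz (Tok α) (UTA.mkItem (d, Option.some q)) =
      sz (Tok α) ((encodeWord d : Str α) ++ Tok.item :: ((encodeName q : Str α) ++ [Tok.close])) :=
        rfl
    have h2 : sz (Tok α) q = sz (Tok α) (encodeName q : Str α) := rfl
    rw [h, h1, sz_some, h2, sz_toks, sz_toks, sz_toks]
    simp; omega

theorem PT.treeStep (hO : PT O (Query.holds (Pat := Pat))) : PT O (treeStep (Pat := Pat)) := by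
  let T : Type := Tok α × Params Pat × Word α × List (List (QItem α))
  let L : Type := List (QItem α)
  have w : PT O fun y : T => y.2.2.1 := fst.comp (snd.comp snd)
  have v : PT O fun y : T => y.2.2.2 := snd.comp (snd.comp snd)
  have s : PT O fun y : T => y.2.2 := snd.comp snd
  have h3 : PT O fun z : (L × List L) × (L × List L) × (L × List L) × T =>
      ((Word.nil : Word α), (UTA.mkItem (z.2.2.2.2.2.1, UTA.value (z.2.2.2.2.1, z.2.1.1)) ::
        z.1.1) ::
        z.1.2) :=
    (const _).pair (((PT.mkItem.comp ((w.comp (snd.comp (snd.comp snd))).pair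
      ((PT.value hO).comp (((fst.comp snd).comp (snd.comp (snd.comp snd))).pair
        (fst.comp (fst.comp snd)))))).cons (fst.comp fst)).cons (snd.comp fst))
  have h2 := listCase (l := fun z : (L × List L) × (L × List L) × T => z.1.2)
    (snd.comp fst) (s.comp (snd.comp snd)) h3
  have h1 := listCase (l := fun z : (L × List L) × T => z.1.2) (snd.comp fst) (s.comp snd) h2
  have h0 := listCase v s h1
  refine (((test Tok.isClose).comp fst).ite ((const Word.nil).pair ((const []).cons v))
    (((test Tok.isLetter).comp fst).ite ((PT.letterCons.comp (fst.pair w)).pair v)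
      h0)).congr fun y => ?_
  obtain ⟨e, g, w, l⟩ := y
  rcases l with _ | ⟨_, _ | ⟨_, _ | _⟩⟩ <;> rfl

theorem PT.readTree (hO : PT O (Query.holds (Pat := Pat))) : PT O (readTree (Pat := Pat)) := by
  have h0 : sz (Tok α) (Word.nil : Word α) = 3 := rfl
  have h := foldl_param (O := O) (PT.treeStep hO) (Polynomial.X + 20) fun e g s => by
    obtain ⟨w, l⟩ := s
    -- Every word is represented with its closing letter, so resetting the current word to the empty
    -- one never increases the size.
    have hw : 3 ≤ sz (Tok α) w := by
      change 3 ≤ sz (Tok α) (encodeWord w : Str α)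
      simp [sz_toks, encodeWord]
    simp only [UTA.treeStep]
    split_ifs
    · simp [h0]; omega
    · have : sz (Tok α) (UTA.letterCons (e, w)) ≤ sz (Tok α) w + 2 := by
        cases e with
        | letter a =>
          change sz (Tok α) (Tok.letter a :: encodeWord w : Str α) ≤
            sz (Tok α) (encodeWord w : Str α) + 2
          rw [sz_cons, sz_tok]; omega
        | _ => exact Nat.le_add_right _ _
      simp at this ⊢; omega
    · rcases l with _ | ⟨K, _ | ⟨M, _ | ⟨N, l⟩⟩⟩
      · simp
      · simp
      · simp
      -- The word moves from the state into the new item, so the growth is due only to the value,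
      -- which is bounded in terms of the parameters.
      · have h1 := sz_value g M
        have h2 := sz_mkItem w (UTA.value (g, M))
        simp [h0] at h1 h2 ⊢; omega
  exact (h.comp ((reverse.comp snd).pair (fst.pair (const _)))).congr fun _ => rfl

theorem PT.memName : PT O memName := by
  have h := foldl_param (O := O) (E := Name) (G := Name) (S := Bool)
    (f := fun y => if decide (y.1 = y.2.1) then true else y.2.2)
    ((PT.nameEq.comp (fst.pair (fst.comp snd))).ite (const true) (snd.comp snd)) (3 : ℕ)
    fun e g s => (sz_bool _ _).trans (by simp)
  exact (h.comp (fst.pair (snd.pair (const false)))).congr fun y => by simp [UTA.memName]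

theorem PT.accepts (hO : PT O (Query.holds (Pat := Pat))) : PT O (accepts (Pat := Pat)) := by
  let T : Type := Params Pat × Str α
  let L : Type := List (QItem α)
  have h2 := listCase (l := fun z : (L × List L) × T => (UTA.value (z.2.1, z.1.1)).toList)
    (f := fun _ => false) (g := fun z => UTA.memName (z.2.2.1.2.1, z.1.1))
    (toList.comp ((PT.value hO).comp ((fst.comp snd).pair (fst.comp fst)))) (const false)
    (PT.memName.comp (((fst.comp snd).comp (fst.comp (snd.comp snd))).pair (fst.comp fst)))
  have h1 := listCase (l := fun y : T => (UTA.readTree y).2) (snd.comp (PT.readTree hO))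
    (const false) h2
  refine h1.congr fun y => ?_
  unfold UTA.accepts
  rcases (UTA.readTree y).2 with _ | ⟨M, _⟩
  · rfl
  · dsimp only
    rcases (UTA.value (y.1, M)).toList with _ | _ <;> rfl

end Algorithm

end UTA

namespace UTA

open Turing PT Relation

section Correctness

variable {α : Type} {Pat : Set (Pattern α)}

/-! ### Reading the input -/

/-- Inputs of the membership problem, represented by their string encoding. -/
def Source (Pat : Set (Pattern α)) : Type := MembershipInstance Pat

instance : Enc (Tok α) (Source Pat) := ⟨fun x => Enc.enc (MembershipInstance.encode x)⟩

/-- The part of an automaton used by the algorithm. -/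
def AUTC.params (C : AUTC Pat) : Params Pat :=
  (((C.H.rules.map fun r => (((r.1, r.2.1), r.2.2) : Rule Pat)).reverse, C.p₀.1),
    (C.A.final.reverse, (C.A.rules.map fun r => ((r.1.1.2.1, r.2) : VRule)).reverse))

/-- Read all parts of the encoding of an automaton. -/
def readAll : Str α → ((((((List (Str α) × List ((Str α × Str α) × Str α)) × Str α) ×
    List (Str α)) × List (Str α)) × List (Str α × Str α)) × Str α) :=
  readBoth (readBoth (readBoth (readBoth (readBoth (readList split)
    (readList (readBoth (readBoth split split) split))) split) (readList split)) (readList split))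
    (readList (readBoth split split))

/-- From a string starting with `u`, the function `t` reads the object `b`. -/
def Reads {B : Type} (t : Str α → B × Str α) (u : Str α) (b : B) : Prop :=
  ∀ s, t (u ++ s) = (b, s)

theorem Reads.both {B B' : Type} {t : Str α → B × Str α} {t' : Str α → B' × Str α} {u u' : Str α}
    {b : B} {b' : B'} (h : Reads t u b) (h' : Reads t' u' b') :
    Reads (readBoth t t') (u ++ u') (b, b') := fun s => by
  rw [List.append_assoc, readBoth, h, h']

theorem Reads.list {B D : Type} {t : Str α → B × Str α} {e : D → Str α} {g : D → B}
    (h : ∀ x, Reads t (e x) (g x)) (l : List D) :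
    Reads (readList t) (encodeList e l) (l.map g).reverse :=
  fun s => readList_append h l s

theorem IsTerm.reads {u : Str α} (h : IsTerm u) : Reads UTA.split u u := h.split

theorem reads_readAll (C : AUTC Pat) : Reads readAll C.encode
    ((((((C.H.states.map encodeName).reverse,
      (C.H.rules.map fun r => ((encodeName r.1, r.2.1.encode), encodeName r.2.2)).reverse),
      encodeName C.p₀.1), (C.A.states.map encodeName).reverse),
      (C.A.final.map encodeName).reverse),
      (C.A.rules.map fun r => (encodeName r.1.1.2.1, encodeName r.2)).reverse) := by
  have hn := fun q : List Bool => IsTerm.reads (isTerm_encodeName (α := α) q)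
  exact (((((Reads.list hn _).both (Reads.list (fun r => ((hn _).both
    (IsTerm.reads r.2.1.isTerm_encode)).both (hn _)) _)).both (hn _)).both (Reads.list hn _)).both
    (Reads.list hn _)).both (Reads.list (fun r => (hn _).both (hn _)) _)

variable {O : TM2ComputableAux (Tok α) Bool}

theorem PT.readAll : PT O (readAll (α := α)) := by
  have s1 : ∀ s : Str α, sz (Tok α) (UTA.split s) ≤ sz (Tok α) s + 2 := fun s => (sz_split s).le
  have h2 : PT O (UTA.readBoth UTA.split UTA.split : Str α → _) := PT.split.readBoth PT.split
  have n := PT.readList (O := O) PT.split 2 s1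
  exact (((((n.readBoth (PT.readList (h2.readBoth PT.split) _
    (sz_readBoth (sz_readBoth s1 s1) s1))).readBoth PT.split).readBoth n).readBoth n).readBoth
    (PT.readList h2 _ (sz_readBoth s1 s1)))

theorem enc_list_congr {A B : Type} [Enc (Tok α) A] [Enc (Tok α) B] {D : Type} {f : D → A}
    {g : D → B} (h : ∀ x, (Enc.enc (f x) : Val (Tok α)) = Enc.enc (g x)) (l : List D) :
    (Enc.enc (l.map f).reverse : Val (Tok α)) = Enc.enc (l.map g).reverse := by
  change List.foldr _ _ _ = List.foldr _ _ _
  rw [← List.map_reverse, ← List.map_reverse, List.foldr_map, List.foldr_map]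
  simp only [h]

/-- Parsing only cuts the string and rearranges the pieces: each name or filter is represented by
the very substring that encodes it. The lists come out reversed because `readList` accumulates them;
their order does not matter later. -/
theorem PT.parse : PT O fun x : Source Pat => (AUTC.params x.1, (TreeTerm.encode x.2 : Str α)) := by
  have r := PT.readAll (O := O)
  have a := fst.comp r
  have h : PT O fun s : Str α => ((((UTA.readAll s).1.1.1.1.1.2, (UTA.readAll s).1.1.1.1.2),
      ((UTA.readAll s).1.1.2, (UTA.readAll s).1.2)), (UTA.readAll s).2) :=
    (((snd.comp (fst.comp (fst.comp (fst.comp (fst.comp a))))).pair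
      (snd.comp (fst.comp (fst.comp (fst.comp a))))).pair
      ((snd.comp (fst.comp a)).pair (snd.comp a))).pair (snd.comp r)
  refine h.of_enc (fun x => MembershipInstance.encode x) (fun _ => rfl) fun x => ?_
  obtain ⟨C, t⟩ := x
  have h1 := reads_readAll C t.encode
  have h2 : MembershipInstance.encode (C, t) = C.encode ++ t.encode := rfl
  rw [h2, h1]
  have e1 := enc_list_congr (α := α) (A := Rule Pat) (B := (Str α × Str α) × Str α)
    (f := fun r : HState × EdgeFilter Pat × HState =>
    (((r.1, r.2.1), r.2.2) : Rule Pat)) (g := fun r =>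
      (((encodeName r.1, r.2.1.encode), encodeName r.2.2) : (Str α × Str α) × Str α))
    (fun _ => rfl) C.H.rules
  have e2 := enc_list_congr (α := α) (A := Name) (B := Str α) (f := fun q : Property => (q : Name))
    (g := fun q =>
    (encodeName q : Str α)) (fun _ => rfl) C.A.final
  have e3 := enc_list_congr (α := α) (A := VRule) (B := Str α × Str α)
    (f := fun r : (C.H.descriptorsFrom C.p₀).Desc × Property =>
    ((r.1.1.2.1, r.2) : VRule)) (g := fun r =>
      ((encodeName r.1.1.2.1, encodeName r.2) : Str α × Str α))
    (fun _ => rfl) C.A.rules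
  have e2' : (C.A.final.map fun q : Property => (q : Name)) = C.A.final := List.map_id _
  replace e2 :=
    (congrArg (fun l : List Name => (Enc.enc l.reverse : Val (Tok α))) e2').symm.trans e2
  change Val.cons (.cons (.cons (Enc.enc _) _) (.cons (Enc.enc _) (Enc.enc _))) _ =
    Val.cons (.cons (.cons (Enc.enc _) _) (.cons (Enc.enc _) (Enc.enc _))) _
  rw [← e1, ← e2, ← e3]
  rfl

/-! ### Greedy runs -/

/-- The multiset of items described by a list. -/
def items (l : List (QItem α)) : Multiset (Item α) := (l.map QItem.toItem : List (Item α))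

/-- No rule can consume `x` in the horizontal state `p`. -/
def Stuck (rs : List (Rule Pat)) (p : Name) (x : QItem α) : Prop :=
  ∀ r ∈ rs, r.1.1 = p → ¬ r.1.2.Sat x.toItem

theorem holds_mkQuery (φ : EdgeFilter Pat) (x : QItem α) :
    (mkQuery (φ, x)).holds = true ↔ φ.Sat x.toItem := by
  classical
  exact decide_eq_true_iff

theorem findRule_true (rs : List (Rule Pat)) (x : QItem α) (p : Name) :
    findRule (rs, x, (p, true)) = (p, true) := by
  induction rs with
  | nil => rfl
  | cons r rs ih => exact ih

theorem findRule_false (rs : List (Rule Pat)) (x : QItem α) (p : Name) :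
    (findRule (rs, x, (p, false)) = (p, false) ∧ Stuck rs p x) ∨
      ∃ r ∈ rs, r.1.1 = p ∧ r.1.2.Sat x.toItem ∧ findRule (rs, x, (p, false)) = (r.2, true) := by
  induction rs with
  | nil => exact .inl ⟨rfl, by simp [Stuck]⟩
  | cons r rs ih =>
    have h : findRule (r :: rs, x, (p, false)) = findRule (rs, x, ruleStep (r, x, (p, false))) :=
      rfl
    by_cases hr : r.1.1 = p ∧ r.1.2.Sat x.toItem
    · refine .inr ⟨r, by simp, hr.1, hr.2, ?_⟩
      have h1 : ruleStep (r, x, (p, false)) = (r.2, true) := by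
        simp [ruleStep, hr.1, (holds_mkQuery _ _).2 hr.2]
      rw [h, h1, findRule_true]
    · have h1 : ruleStep (r, x, (p, false)) = (p, false) := by
        by_cases hp : r.1.1 = p
        · have h2 : (mkQuery (r.1.2, x)).holds = false := by
            rw [← Bool.not_eq_true, holds_mkQuery]
            exact fun hs => hr ⟨hp, hs⟩
          simp [ruleStep, h2]
        · simp [ruleStep, hp]
      rw [h, h1]
      rcases ih with ⟨h2, h3⟩ | ⟨r', hr', h2⟩
      · refine .inl ⟨h2, ?_⟩
        intro r' hr' hp hs
        rcases List.mem_cons.1 hr' with rfl | hr'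
        · exact hr ⟨hp, hs⟩
        · exact h3 r' hr' hp hs
      · exact .inr ⟨r', by simp [hr'], h2⟩

/-- `rs` lists the rules of `H`. -/
def Lists (rs : List (Rule Pat)) (H : HAut Pat) : Prop :=
  ∀ r : Rule Pat, r ∈ rs ↔ (r.1.1, r.1.2, r.2) ∈ H.rules

variable {H : HAut Pat} {rs : List (Rule Pat)}

theorem passStep_spec (hrs : Lists rs H) (x : QItem α) (p : Name) (l : List (QItem α)) :
    (passStep (x, rs, p, l) = (p, x :: l) ∧ Stuck rs p x) ∨
      ∃ p', passStep (x, rs, p, l) = (p', l) ∧ ∀ M, H.Rew (p, x.toItem ::ₘ M) (p', M) := by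
  rcases findRule_false rs x p with ⟨h, hs⟩ | ⟨r, hr, hp, hs, h⟩
  · exact .inl ⟨by simp [passStep, h], hs⟩
  · refine .inr ⟨r.2, by simp [passStep, h], fun M => .read M (φ := r.1.2) ?_ hs⟩
    rw [← hp]
    exact (hrs r).1 hr

/-- The final alternative is the measure of progress: either an item is consumed, or the horizontal
state has never changed and every item was tested against that same state. -/
theorem passFold_spec (hrs : Lists rs H) (l : List (QItem α)) (s : Name × List (QItem α)) :
    ReflTransGen H.Rew (s.1, items l + items s.2)
        ((l.foldl (fun s e => passStep (e, rs, s)) s).1,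
          items (l.foldl (fun s e => passStep (e, rs, s)) s).2) ∧
      (l.foldl (fun s e => passStep (e, rs, s)) s).2.length ≤ l.length + s.2.length ∧
      ((l.foldl (fun s e => passStep (e, rs, s)) s).2.length < l.length + s.2.length ∨
        (l.foldl (fun s e => passStep (e, rs, s)) s = (s.1, l.reverse ++ s.2) ∧
          ∀ x ∈ l, Stuck rs s.1 x)) := by
  induction l generalizing s with
  | nil => exact ⟨by simpa [items] using ReflTransGen.refl, by simp, .inr (by simp)⟩
  | cons x l ih =>
    obtain ⟨p, m⟩ := s
    rw [List.foldl_cons]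
    have hx : items (x :: l) = x.toItem ::ₘ items l := rfl
    rcases passStep_spec hrs x p m with ⟨h, hs⟩ | ⟨p', h, hs⟩
    · rw [h]
      obtain ⟨h1, h2, h3⟩ := ih (p, x :: m)
      refine ⟨?_, by simp at h2 ⊢; omega, ?_⟩
      · rw [hx]
        rwa [show items (x :: m) = x.toItem ::ₘ items m from rfl, Multiset.add_cons,
          ← Multiset.cons_add] at h1
      · rcases h3 with h3 | ⟨h3, h4⟩
        · left; simp at h3 ⊢; omega
        · exact .inr ⟨by simpa using h3, by simpa using ⟨hs, h4⟩⟩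
    · rw [h]
      obtain ⟨h1, h2, h3⟩ := ih (p', m)
      refine ⟨.head (b := (p', items l + items m)) ?_ h1, by simp at h2 ⊢; omega,
        .inl (by simp at h2 ⊢; omega)⟩
      rw [hx, Multiset.cons_add]
      exact hs _

theorem pass_spec (hrs : Lists rs H) (p : Name) (l : List (QItem α)) :
    ReflTransGen H.Rew (p, items l) ((pass (rs, p, l)).1, items (pass (rs, p, l)).2) ∧
      ((pass (rs, p, l)).2.length < l.length ∨
        (pass (rs, p, l) = (p, l.reverse) ∧ ∀ x ∈ l, Stuck rs p x)) := by
  obtain ⟨h1, _, h3⟩ := passFold_spec hrs l (p, [])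
  exact ⟨by simpa [items, pass] using h1, by simpa [pass] using h3⟩

theorem pass_of_stuck (p : Name) (l : List (QItem α))
    (h : ∀ x ∈ l, Stuck rs p x) : pass (rs, p, l) = (p, l.reverse) := by
  have key : ∀ (l m : List (QItem α)), (∀ x ∈ l, Stuck rs p x) →
      l.foldl (fun s e => passStep (e, rs, s)) (p, m) = (p, l.reverse ++ m) := by
    intro l
    induction l with
    | nil => intro m _; rfl
    | cons x l ih =>
      intro m h
      have h1 : findRule (rs, x, (p, false)) = (p, false) := by
        rcases findRule_false rs x p with h1 | ⟨r, hr, hp, hs, _⟩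
        · exact h1.1
        · exact absurd hs (h x (by simp) r hr hp)
      have h2 : passStep (x, rs, p, m) = (p, x :: m) := by simp [passStep, h1]
      rw [List.foldl_cons, h2, ih _ fun y hy => h y (by simp [hy])]
      simp
  simpa [pass] using key l [] h

/-- An item skipped earlier may become consumable after a change of state, so passes are repeated.
Each pass shortens the list or shows that it is stuck, so as many passes as there are items suffice.
-/
theorem run_spec (hrs : Lists rs H) (p : Name) (l : List (QItem α)) :
    ReflTransGen H.Rew (p, items l) ((run (rs, p, l)).1, items (run (rs, p, l)).2) ∧
      ∀ x ∈ (run (rs, p, l)).2, Stuck rs (run (rs, p, l)).1 x := by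
  have key : ∀ (f : List (QItem α)) (s : Name × List (QItem α)),
      ReflTransGen H.Rew (s.1, items s.2)
          ((f.foldl (fun s _ => pass (rs, s)) s).1,
            items (f.foldl (fun s _ => pass (rs, s)) s).2) ∧
        ((s.2.length ≤ f.length ∨ ∀ x ∈ s.2, Stuck rs s.1 x) →
          ∀ x ∈ (f.foldl (fun s _ => pass (rs, s)) s).2,
            Stuck rs (f.foldl (fun s _ => pass (rs, s)) s).1 x) := by
    intro f
    induction f with
    | nil =>
      intro s
      refine ⟨.refl, ?_⟩
      rintro (h | h)
      · simp [List.length_eq_zero_iff.1 (Nat.le_zero.1 h)]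
      · exact h
    | cons y f ih =>
      rintro ⟨p, m⟩
      rw [List.foldl_cons]
      obtain ⟨h1, h2⟩ := pass_spec hrs p m
      obtain ⟨h3, h4⟩ := ih (pass (rs, p, m))
      refine ⟨h1.trans h3, fun h => h4 ?_⟩
      -- A pass over stuck items merely reverses the list, so being stuck persists.
      have hst : (∀ x ∈ m, Stuck rs p x) →
          ∀ x ∈ (pass (rs, p, m)).2, Stuck rs (pass (rs, p, m)).1 x := fun h => by
        rw [pass_of_stuck p m h]
        simpa using h
      rcases h with h | h
      · rcases h2 with h2 | h2
        · left; simp at h; omega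
        · exact .inr (hst h2.2)
      · exact .inr (hst h)
  exact ⟨(key l (p, l)).1, (key l (p, l)).2 (.inl le_rfl)⟩

/-! ### Confluence -/

theorem HAut.RewFail.of_zero {p : HState} {c : Option (HState × Multiset (Item α))}
    (h : ReflTransGen H.RewFail (some (p, 0)) c) : c = some (p, 0) := by
  rcases h.cases_head with h | ⟨d, h, _⟩
  · exact h.symm
  · generalize hM : ((p, 0) : HState × Multiset (Item α)) = x at h
    cases h with
    | step h =>
      cases h with
      | read M _ _ =>
        have := congrArg Prod.snd hM
        exact absurd this.symm (Multiset.cons_ne_zero)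
    | fail hM' _ => exact absurd (congrArg Prod.snd hM).symm hM'

theorem HAut.RewFail.of_none {c : Option (HState × Multiset (Item α))}
    (h : ReflTransGen H.RewFail none c) : c = none := by
  rcases h.cases_head with h | ⟨d, h, _⟩
  · exact h.symm
  · cases h

theorem HAut.Rew.lift {a b : HState × Multiset (Item α)} (h : ReflTransGen H.Rew a b) :
    ReflTransGen H.RewFail (some a) (some b) := by
  induction h with
  | refl => exact .refl
  | tail _ h ih => exact ih.tail (.step h)

/-- Greedy runs decide satisfaction of descriptors of confluent automata. -/
theorem run_iff (hrs : Lists rs H) (hH : H.Confluent) (p p' : Name) (l : List (QItem α)) :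
    ReflTransGen H.Rew (p, items l) (p', 0) ↔
      (run (rs, p, l)).2 = [] ∧ (run (rs, p, l)).1 = p' := by
  obtain ⟨h1, h2⟩ := run_spec hrs p l
  generalize hr : run (rs, p, l) = r at h1 h2
  obtain ⟨p₁, m⟩ := r
  constructor
  · intro h
    rcases m with _ | ⟨x, m⟩
    -- Both runs consume everything; their end configurations are irreducible, so having a common
    -- reduct makes them equal.
    · obtain ⟨d, hd, hd'⟩ := hH _ _ _ (HAut.Rew.lift h) (HAut.Rew.lift h1)
      have e1 := HAut.RewFail.of_zero hd
      have e2 := HAut.RewFail.of_zero hd'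
      rw [e1] at e2
      exact ⟨rfl, (congrArg Prod.fst (Option.some.inj e2)).symm⟩
    -- The greedy run leaves stuck items, so it continues to `⊥`; but `⊥` and `(p', 0)` are distinct
    -- irreducible configurations and cannot be joined.
    · have h3 : H.RewFail (some (p₁, items (x :: m))) none := by
        refine .fail (M := x.toItem ::ₘ items m) Multiset.cons_ne_zero ?_
        rintro ⟨c, hc⟩
        generalize hM : ((p₁, x.toItem ::ₘ items m) : HState × Multiset (Item α)) = y at hc
        cases hc with
        | @read q q' φ y M hq hs =>
          obtain rfl : p₁ = q := congrArg Prod.fst hM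
          have hM' : items (x :: m) = y ::ₘ M := congrArg Prod.snd hM
          have hy : y ∈ items (x :: m) := hM' ▸ Multiset.mem_cons_self y M
          obtain ⟨z, hz, rfl⟩ := List.mem_map.1 (Multiset.mem_coe.1 hy)
          exact h2 z hz ((p₁, φ), q') ((hrs _).2 hq) rfl hs
      obtain ⟨d, hd, hd'⟩ := hH _ _ _ (HAut.Rew.lift h) ((HAut.Rew.lift h1).tail h3)
      rw [HAut.RewFail.of_zero hd] at hd'
      exact absurd (HAut.RewFail.of_none hd') (by simp)
  · rintro ⟨rfl, rfl⟩
    exact h1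

/-! ### Correctness of the algorithm -/

theorem target_none {vs : List VRule} {p : Name} (h : target (vs, p) = none) (q : Name) :
    (p, q) ∉ vs := by
  have key : ∀ (vs : List VRule) (s : Option Name),
      vs.foldl (fun s e => targetStep (e, p, s)) s = none → s = none ∧ (p, q) ∉ vs := by
    intro vs
    induction vs with
    | nil => intro s h; exact ⟨h, by simp⟩
    | cons v vs ih =>
      intro s h
      obtain ⟨h1, h2⟩ := ih _ h
      by_cases hp : v.1 = p
      · simp [targetStep, hp] at h1
      · simp only [targetStep, hp, if_false] at h1
        refine ⟨h1, fun hm => ?_⟩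
        rcases List.mem_cons.1 hm with rfl | hm
        · exact hp rfl
        · exact h2 hm
  exact (key vs none h).2

namespace AUTC

variable (C : AUTC Pat)

theorem lists_params : Lists C.params.1.1 C.H := by
  intro r
  obtain ⟨⟨p, φ⟩, p'⟩ := r
  simp only [params, List.mem_reverse, List.mem_map]
  constructor
  · rintro ⟨⟨_, _, _⟩, h, e⟩
    cases e
    exact h
  · exact fun h => ⟨_, h, rfl⟩

theorem mem_vrules (p' q : Name) :
    (p', q) ∈ C.params.2.2 ↔ ∃ h, (h, q) ∈ C.A.rules ∧ h.1.2.1 = p' := by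
  simp only [params, List.mem_reverse, List.mem_map]
  constructor
  · rintro ⟨⟨h, q'⟩, hr, e⟩
    cases e
    exact ⟨h, hr, rfl⟩
  · rintro ⟨h, hr, rfl⟩
    exact ⟨_, hr, rfl⟩

/-- All descriptors in the vertical rules start from `p₀`, so the end of one greedy run determines
which of them are satisfied. -/
theorem mem_targets (l : List (QItem α)) (q : Name) :
    q ∈ C.A.targets (items l) ↔
      (run (C.params.1.1, C.p₀.1, l)).2 = [] ∧
        ((run (C.params.1.1, C.p₀.1, l)).1, q) ∈ C.params.2.2 := by
  have key : ∀ h : (C.H.descriptorsFrom C.p₀).Desc,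
      (C.H.descriptorsFrom C.p₀).Sat (items l) h ↔
        (run (C.params.1.1, C.p₀.1, l)).2 = [] ∧
          (run (C.params.1.1, C.p₀.1, l)).1 = h.1.2.1 := by
    intro h
    have hp : C.p₀.1 = h.1.1.1 := congrArg Subtype.val h.2.symm
    refine Iff.trans ?_ (run_iff C.lists_params C.confluent C.p₀.1 h.1.2.1 l)
    exact (iff_of_eq (congrArg (fun p : Name =>
      ReflTransGen C.H.Rew (p, items l) ((h.1.2.1 : Name), 0)) hp)).symm
  constructor
  · rintro ⟨h, hr, hs⟩
    obtain ⟨h1, h2⟩ := (key h).1 hs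
    exact ⟨h1, (C.mem_vrules _ _).2 ⟨h, hr, h2.symm⟩⟩
  · rintro ⟨h1, h2⟩
    obtain ⟨h, hr, hs⟩ := (C.mem_vrules _ _).1 h2
    exact ⟨h, hr, (key h).2 ⟨h1, hs.symm⟩⟩

theorem value_eq (l : List (QItem α)) (hl : (C.A.targets (items l)).Subsingleton) :
    {q | value (C.params, l) = some q} = C.A.targets (items l) := by
  ext q
  refine Iff.trans ?_ (C.mem_targets l q).symm
  rw [Set.mem_ofPred_eq]
  have hp : C.params.1.2 = C.p₀.1 := rfl
  by_cases h : (run (C.params.1.1, C.p₀.1, l)).2 = []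
  · simp only [value, hp, h, List.isEmpty_nil, if_true, true_and]
    rcases target_mem C.params.2.2 (run (C.params.1.1, C.p₀.1, l)).1 with h1 | ⟨q', h1, h2⟩
    · rw [h1]
      exact ⟨fun h => by simp at h, fun h => absurd h (target_none h1 q)⟩
    · rw [h2]
      refine ⟨fun h => by cases h; exact h1, fun h3 => congrArg _ ?_⟩
      -- Several vertical rules may match; by determinism they have the same right-hand side, so
      -- keeping only the last one loses nothing.
      exact hl ((C.mem_targets l q').2 ⟨h, h1⟩) ((C.mem_targets l q).2 ⟨h, h3⟩)
  · simp [value, hp, h]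

/-- The list of items computed for a tree. -/
noncomputable def annotated : TreeTerm α → List (QItem α)
  | .empty => []
  | .add d t s => mkItem (d, value (C.params, annotated t)) :: annotated s

/-- Determinism is applied at every subtree: it allows the set of states in the annotation to be
stored as an optional single state. -/
theorem items_annotated (t : TreeTerm α) : items (C.annotated t) = C.A.annotate t := by
  induction t with
  | empty => rfl
  | add d t s iht ihs =>
    have h : (C.A.targets (items (C.annotated t))).Subsingleton := by
      rw [iht]
      exact C.deterministic t.toTree
    change (d, {q | value (C.params, C.annotated t) = some q}) ::ₘ items (C.annotated s) = _
    rw [C.value_eq _ h, iht, ihs]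
    rfl

theorem readTree_encode (t : TreeTerm α) :
    (readTree (C.params, t.encode)).2 = [C.annotated t] := by
  have hw : ∀ (d : List α) (w : Word α) (v : List (List (QItem α))),
      (encodeWord d).foldr (fun e s => treeStep (e, C.params, s)) (w, v) = (d, [] :: v) := by
    intro d w v
    induction d with
    | nil => rfl
    | cons a d ih =>
      change treeStep (.letter a, C.params,
        (encodeWord d).foldr (fun e s => treeStep (e, C.params, s)) (w, v)) = _
      rw [ih]
      rfl
  have key : ∀ (t : TreeTerm α) (w : Word α) (v : List (List (QItem α))),
      t.encode.foldr (fun e s => treeStep (e, C.params, s)) (w, v) =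
        (Word.nil, C.annotated t :: v) := by
    intro t
    induction t with
    | empty => intro w v; rfl
    | add d t s iht ihs =>
      intro w v
      -- From right to left, `s` and then `t` are pushed, and the end of the word pushes an extra
      -- empty list. At `item` the stack therefore shows this list, the items of `t` and those of
      -- `s`.
      rw [TreeTerm.encode, List.foldr_cons, List.foldr_append, List.foldr_append, ihs, iht, hw]
      rfl
  rw [readTree, List.foldl_reverse, key]

theorem accepts_iff (t : TreeTerm α) :
    accepts (C.params, t.encode) = true ↔ t.toTree ∈ C.language := by
  have hm : ∀ (l : List Name) (q : Name), memName (l, q) = true ↔ q ∈ l := by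
    intro l q
    have : ∀ (l : List Name) (s : Bool),
        l.foldl (fun s e => if e = q then true else s) s = true ↔ s = true ∨ q ∈ l := by
      intro l
      induction l with
      | nil => simp
      | cons a l ih =>
        intro s
        rw [List.foldl_cons, ih]
        by_cases h : a = q
        · simp [h]
        · simp [h, Ne.symm h]
    simpa [memName] using this l false
  have hv : {q | value (C.params, C.annotated t) = some q} = C.A.targets (C.A.annotate t) := by
    have h : (C.A.targets (items (C.annotated t))).Subsingleton := by
      rw [items_annotated]
      exact C.deterministic t.toTree
    rw [C.value_eq _ h, items_annotated]
  have hL : t.toTree ∈ C.language ↔ ∃ q ∈ C.A.targets (C.A.annotate t), q ∈ C.A.final := Iff.rfl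
  have hf : ∀ q : Name, q ∈ C.params.2.1 ↔ q ∈ C.A.final := fun q => List.mem_reverse
  rw [hL, ← hv, accepts, readTree_encode]
  cases hq : value (C.params, C.annotated t) with
  | none =>
    refine ⟨fun h => absurd h (by simp [hq]), fun ⟨q, h, _⟩ => ?_⟩
    cases h
  | some q =>
    refine Iff.trans (b := q ∈ C.A.final) (by simp [hq, hm, hf]) ⟨fun h => ⟨q, rfl, h⟩, ?_⟩
    rintro ⟨q', h, hq'⟩
    cases h
    exact hq'

end AUTC

end Correctness

end UTA

theorem mainTheorem1 {α : Type} [Fintype α] (Pat : Set (UTA.Pattern α))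
    (hfilters : UTA.InPTime (UTA.SingletonInstance.encode (Pat := Pat))
      UTA.SingletonInstance.Holds) :
    UTA.InPTime (UTA.MembershipInstance.encode (Pat := Pat)) UTA.MembershipInstance.Holds := by
  obtain ⟨h⟩ := hfilters
  -- The default letter only makes the feeding of the subroutine total; on lists of letters it is
  -- never used.
  let _ : Inhabited (UTA.Tok α) := ⟨.close⟩
  have hO : UTA.PT h.toTM2ComputableAux (UTA.Query.holds (Pat := Pat)) :=
    UTA.PT.oracle h.time UTA.SingletonInstance.encode (fun _ => UTA.code_list _ _) h.outputsFun
  exact UTA.PT.inPTime (A := UTA.Source Pat) ((UTA.PT.accepts hO).comp UTA.PT.parse)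
    UTA.MembershipInstance.encode (fun _ => UTA.code_list _ _) fun x => x.1.accepts_iff x.2
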